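/- Let $F$ be an algebraically closed field with $\operatorname{char}(F)\neq 2,3$. For a finite group $G$ and a finite dimensional $G$-module $V$ over $F$, let $F[V]=\mathrm{Sym}(V^*)$ be the coordinate ring of $V$ with its standard grading, and let $F[V]^G$ be the algebra of polynomial invariants, where $G$ acts by $F$-algebra automorphisms extending $x^g(v)=x(gv)$ for $x\in V^*$, $g\in G$, $v\in V$. Let $\beta(G,V)$ be the minimal $d\in\mathbb{N}$ such that $F[V]^G$ is generated as an $F$-algebra by its homogeneous elements of degree at most $d$, and let $\beta(G)=\sup_V\beta(G,V)$, where $V$ runs through all finite dimensional $G$-modules over $F$. Let $G=(\mathbb{Z}/2\times\mathbb{Z}/2)\rtimes\mathbb{Z}/9$ be a non-abelian semidirect product (it is unique up to isomorphism). Then $\beta(G)\le 17$. -/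

import Mathlib

open scoped SemidirectProduct

universe u v

namespace InvariantTheory

noncomputable section

variable (F : Type u) [Field F] (V : Type v) [AddCommGroup V] [Module F V]

/-- The coordinate ring `F[V]`: the symmetric algebra of the dual space of `V`. -/
abbrev CoordRing : Type (max u v) := SymmetricAlgebra F (Module.Dual F V)

/-- The homogeneous component `F[V]_d`: the span of the `d`-fold products of linear forms
(for `d = 0` these are the constants). -/
def homogeneousPart (d : ℕ) : Submodule F (CoordRing F V) :=
  LinearMap.range (SymmetricAlgebra.ι F (Module.Dual F V)) ^ d

variable {F V}
variable {G : Type*} [Group G]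

/-- The algebra endomorphism `f ↦ f ^ g` of `F[V]`: the multiplicative extension of
`x ↦ x ^ g` on linear forms, where `(x ^ g) v = x (g v)`. -/
def act (ρ : Representation F G V) (g : G) : CoordRing F V →ₐ[F] CoordRing F V :=
  SymmetricAlgebra.lift (SymmetricAlgebra.ι F (Module.Dual F V) ∘ₗ (ρ g).dualMap)

/-- The algebra of polynomial invariants `F[V]^G`. -/
def invariantAlgebra (ρ : Representation F G V) : Subalgebra F (CoordRing F V) :=
  ⨅ g : G, AlgHom.equalizer (act ρ g) (AlgHom.id F (CoordRing F V))

/-- `F[V]^G` is generated as an `F`-algebra by its homogeneous elements of degree at most `d`. -/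
def GeneratedInDegreeLE (ρ : Representation F G V) (d : ℕ) : Prop :=
  Algebra.adjoin F
      {f : CoordRing F V | f ∈ invariantAlgebra ρ ∧ ∃ i ≤ d, f ∈ homogeneousPart F V i} =
    invariantAlgebra ρ

/-- The Noether number `β(G, V)` of a `G`-module `V`: the least `d` such that `F[V]^G` is
generated in degrees at most `d` (and `⊤` if there is no such `d`). -/
def moduleNoetherNumber (ρ : Representation F G V) : ℕ∞ :=
  ⨅ (d : ℕ) (_ : GeneratedInDegreeLE ρ d), (d : ℕ∞)

variable (F G) in
/-- The Noether number `β(G)` over `F`: the supremum of `β(G, V)` over all finite dimensional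
`G`-modules `V` over `F`. Every such module is isomorphic to one in the universe of `F`
(namely to some `F ^ n`). -/
def noetherNumber : ℕ∞ :=
  ⨆ (V : Type u) (_ : AddCommGroup V) (_ : Module F V) (_ : FiniteDimensional F V)
    (ρ : Representation F G V), moduleNoetherNumber ρ

end

end InvariantTheory

/-! Let N be the Klein four-group and γ a generator of ℤ/9. Since γ permutes the three nontrivial
characters of N cyclically, γ³ commutes with N. Linear forms are spanned by N-invariant
γ-eigenvectors and by the γ-rotations of "letters": γ³-eigenvectors of one fixed nontrivial
N-character. Two letters in the same rotation multiply to an N-invariant, a sum of γ-eigenvectors.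
So the degree d part is spanned by products of N-invariant γ-eigenvectors of degree 1 and 2 with a
square-free product of rotated letters (`pow_le_span_standardProducts`). Averaging over N kills the
latter unless it is empty or uses all three rotations. Invariants are thus spanned by products of
γ-eigenvectors of degree 1 and 2 and at most one of degree 3, with weights in ℤ/9 summing to zero.

In degree at least 18 such a product has at least nine factors. It contains a proper zero-sum
subproduct unless there are exactly nine, all of one weight e of order 9; then at least seven are
quadratic, and three of these, wᵢ = uᵢvᵢ before projection, have uᵢ with the same γ³-eigenvalue.
Modulo products with unequal weights, these three can be traded for an eigencomponent of w₁·γw₂·γ²w₃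
(`nine_mul_cyclic_sum`). Regrouped as (u₁·γu₂·γ²u₃)(v₁·γv₂·γ²v₃), this yields cubic N-invariants
with weights in 3ℤ/9, and such a weight is completed to zero by none, three or all of the other six
factors. -/

namespace InvariantTheory

/-! ### Zero-sum sequences over ℤ/n -/

section ZeroSum

variable {α : Type*}

/-- The block between two equal prefix sums has sum zero; `i < j` makes it nonempty and `j <
l.length` makes its complement nonempty. -/
theorem exists_split_of_sum_take_eq {A : Type*} [AddCommGroup A] (wt : α → A) (l : List α)
    {i j : ℕ} (hij : i < j) (hj : j < l.length)
    (h : ((l.take i).map wt).sum = ((l.take j).map wt).sum) :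
    ∃ Y Z : Multiset α, (l : Multiset α) = Y + Z ∧ Y ≠ 0 ∧ Z ≠ 0 ∧ (Y.map wt).sum = 0 := by
  have h1 : l.take j = l.take i ++ (l.drop i).take (j - i) := by
    rw [← List.take_add]; congr 1; omega
  refine ⟨((l.drop i).take (j - i) : List α), (l.take i ++ l.drop j : List α), ?_, ?_, ?_, ?_⟩
  · have : l = l.take i ++ (l.drop i).take (j - i) ++ l.drop j := by
      rw [← h1, List.take_append_drop]
    conv_lhs => rw [this]
    simp only [← Multiset.coe_add]
    abel
  · rw [Ne, Multiset.coe_eq_zero, ← List.length_eq_zero_iff]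
    simp only [List.length_take, List.length_drop]; omega
  · rw [Ne, Multiset.coe_eq_zero, ← List.length_eq_zero_iff]
    simp only [List.length_append, List.length_take, List.length_drop]; omega
  · rw [h1, List.map_append, List.sum_append] at h
    rw [Multiset.map_coe, Multiset.sum_coe]
    simpa using h.symm

/-- Pigeonhole on the n + 1 prefix sums of lengths 0, …, n. -/
theorem exists_zeroSum_split_of_lt_card {n : ℕ} [NeZero n] (wt : α → ZMod n) (W : Multiset α)
    (hW : n < W.card) :
    ∃ Y Z : Multiset α, W = Y + Z ∧ Y ≠ 0 ∧ Z ≠ 0 ∧ (Y.map wt).sum = 0 := by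
  induction W using Quotient.inductionOn with
  | _ l =>
  simp only [Multiset.quot_mk_to_coe, Multiset.coe_card] at hW ⊢
  obtain ⟨i, j, hne, h⟩ := Fintype.exists_ne_map_eq_of_card_lt
    (fun i : Fin (n + 1) => ((l.take i).map wt).sum) (by simp [ZMod.card])
  rcases lt_or_gt_of_ne hne with hij | hij
  · exact exists_split_of_sum_take_eq wt l hij (by omega) h
  · exact exists_split_of_sum_take_eq wt l hij (by omega) h.symm

/-- Pigeonhole on the n prefix sums of lengths 0, …, n - 1 of a list starting x, y, together with
the extra value `wt y`. If the extra value equals a prefix sum of length at least 2, deleting y from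
that prefix leaves a zero-sum part. -/
theorem exists_zeroSum_split_of_ne {n : ℕ} [NeZero n] (wt : α → ZMod n) (W : Multiset α)
    (x y : α) (hxy : wt x ≠ wt y) (hW : n ≤ (x ::ₘ y ::ₘ W).card) :
    ∃ Y Z : Multiset α, x ::ₘ y ::ₘ W = Y + Z ∧ Y ≠ 0 ∧ Z ≠ 0 ∧ (Y.map wt).sum = 0 := by
  induction W using Quotient.inductionOn with
  | _ l =>
  simp only [Multiset.quot_mk_to_coe, Multiset.card_cons, Multiset.coe_card] at hW ⊢
  obtain ⟨i, j, hne, h⟩ := Fintype.exists_ne_map_eq_of_card_lt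
    (fun i : Option (Fin n) => i.elim (wt y) fun i => (((x :: y :: l).take i).map wt).sum)
    (by simp [ZMod.card])
  have key : ∀ i : Fin n, wt y = (((x :: y :: l).take i).map wt).sum →
      ∃ Y Z : Multiset α, x ::ₘ y ::ₘ (l : Multiset α) = Y + Z ∧ Y ≠ 0 ∧ Z ≠ 0 ∧
        (Y.map wt).sum = 0 := by
    rintro ⟨i, hi⟩ h
    obtain _ | _ | i := i
    · refine ⟨{y}, x ::ₘ l, ?_, by simp, by simp, by simpa using h⟩
      rw [Multiset.cons_swap, Multiset.singleton_add]
    · exact absurd (by simpa using h.symm) hxy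
    · refine ⟨x ::ₘ (l.take i : List α), y ::ₘ (l.drop i : List α), ?_, by simp, by simp, ?_⟩
      · conv_lhs => rw [← List.take_append_drop i l, ← Multiset.coe_add]
        simp only [← Multiset.singleton_add]
        abel
      · simp only [List.take_succ_cons, List.map_cons, List.sum_cons] at h
        simp only [Multiset.map_cons, Multiset.map_coe, Multiset.sum_cons, Multiset.sum_coe]
        linear_combination -h
  match i, j, hne, h with
  | none, none, hne, _ => exact absurd rfl hne
  | none, some j, _, h => exact key j h
  | some i, none, _, h => exact key i h.symm
  | some i, some j, hne, h =>
    have hne' : i ≠ j := fun h => hne (by rw [h])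
    have := i.2
    have := j.2
    rcases lt_or_gt_of_ne hne' with hij | hij
    · exact exists_split_of_sum_take_eq wt (x :: y :: l) hij (by simp; omega) h
    · exact exists_split_of_sum_take_eq wt (x :: y :: l) hij (by simp; omega) h.symm

theorem exists_three_le_card_filter (W : Multiset α) (p : Fin 3 → α → Prop)
    [∀ i, DecidablePred (p i)] (hp : ∀ a ∈ W, ∃ i, p i a) (hW : 7 ≤ W.card) :
    ∃ i, 3 ≤ (W.filter (p i)).card := by
  by_contra! h
  have : W.card ≤ ∑ i, (W.filter (p i)).card := by
    clear hW h
    induction W using Multiset.induction_on with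
    | empty => simp
    | cons a W ih =>
      have h1 := ih fun b hb => hp b (Multiset.mem_cons_of_mem hb)
      obtain ⟨i, hi⟩ := hp a (Multiset.mem_cons_self a W)
      rw [Multiset.card_cons]
      refine (Nat.add_le_add_right h1 1).trans (Nat.succ_le_of_lt ?_)
      refine Finset.sum_lt_sum (fun j _ => Multiset.card_le_card
        (Multiset.filter_le_filter _ (Multiset.le_cons_self W a))) ⟨i, Finset.mem_univ i, ?_⟩
      rw [Multiset.filter_cons_of_pos _ hi, Multiset.card_cons]
      exact Nat.lt_succ_self _
  rw [Fin.sum_univ_three] at this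
  have := h 0
  have := h 1
  have := h 2
  omega

end ZeroSum
-- Eigencomponents of γ and their Fourier identities
/-- A graded algebra generated by `L`, with automorphisms `σ`, `τ`, `γ` satisfying the relations of
`(ℤ/2 × ℤ/2) ⋊ ℤ/9`, and a faithful character `χ` of `ℤ/9`. -/
structure TwistedTetrahedralAction (F : Type*) (R : Type*) [Field F] [CommRing R] [Algebra F R] where
  L : Submodule F R
  σ : R →ₐ[F] R
  τ : R →ₐ[F] R
  γ : R →ₐ[F] R
  χ : AddChar (ZMod 9) F
  two_ne_zero : (2 : F) ≠ 0
  three_ne_zero : (3 : F) ≠ 0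
  chi_three : χ 3 ^ 2 + χ 3 + 1 = 0
  σ_mem : ∀ x ∈ L, σ x ∈ L
  τ_mem : ∀ x ∈ L, τ x ∈ L
  γ_mem : ∀ x ∈ L, γ x ∈ L
  σ_σ : ∀ x, σ (σ x) = x
  τ_τ : ∀ x, τ (τ x) = x
  σ_τ : ∀ x, σ (τ x) = τ (σ x)
  σ_γ : ∀ x, σ (γ x) = γ (τ x)
  τ_γ : ∀ x, τ (γ x) = γ (σ (τ x))
  γ_nine : ∀ x, γ (γ (γ (γ (γ (γ (γ (γ (γ x)))))))) = x

namespace TwistedTetrahedralAction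

variable {F R : Type*} [Field F] [CommRing R] [Algebra F R] (D : TwistedTetrahedralAction F R)

theorem chi_mul (a b : ZMod 9) : D.χ a * D.χ b = D.χ (a + b) := (D.χ.map_add_eq_mul a b).symm

/-- Elements of degree `d` fixed by `σ`, `τ` and on which `γ` acts as `χ e`. -/
def Inv (d : ℕ) (e : ZMod 9) : Submodule F R where
  carrier := {x | x ∈ D.L ^ d ∧ D.σ x = x ∧ D.τ x = x ∧ D.γ x = D.χ e • x}
  add_mem' := by
    rintro x y ⟨h1, h2, h3, h4⟩ ⟨k1, k2, k3, k4⟩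
    exact ⟨add_mem h1 k1, by simp [h2, k2], by simp [h3, k3], by simp [h4, k4]⟩
  zero_mem' := by simp
  smul_mem' := by
    rintro c x ⟨h1, h2, h3, h4⟩
    exact ⟨Submodule.smul_mem _ c h1, by simp [h2], by simp [h3], by rw [map_smul, h4, smul_comm]⟩

variable {D}

theorem mul_mem_Inv {d d' : ℕ} {e e' : ZMod 9} {x y : R} (hx : x ∈ D.Inv d e)
    (hy : y ∈ D.Inv d' e') : x * y ∈ D.Inv (d + d') (e + e') := by
  obtain ⟨h1, h2, h3, h4⟩ := hx
  obtain ⟨k1, k2, k3, k4⟩ := hy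
  refine ⟨by rw [pow_add]; exact Submodule.mul_mem_mul h1 k1, by simp [h2, k2], by simp [h3, k3], ?_⟩
  rw [map_mul, h4, k4, smul_mul_smul_comm, chi_mul]

theorem one_mem_Inv : (1 : R) ∈ D.Inv 0 0 :=
  ⟨by rw [pow_zero]; exact Submodule.one_le.mp le_rfl, by simp, by simp, by simp⟩

theorem γ_mem_pow {d : ℕ} {x : R} (hx : x ∈ D.L ^ d) : D.γ x ∈ D.L ^ d := by
  have : (D.L ^ d).map D.γ.toLinearMap ≤ D.L ^ d := by
    rw [Submodule.map_pow]
    exact pow_le_pow_left' (by rintro _ ⟨y, hy, rfl⟩; exact D.γ_mem y hy) d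
  exact this ⟨x, hx, rfl⟩

variable (D) in
/-- Three times the projection to the `χ e`-eigenspace of `γ` inside an eigenspace of `γ³`. -/
def twist (e : ZMod 9) (z : R) : R := z + D.χ (-e) • D.γ z + D.χ (-e - e) • D.γ (D.γ z)

theorem twist_eq (e : ZMod 9) (z : R) :
    D.twist e z = z + D.χ (-e) • D.γ z + D.χ (-e - e) • D.γ (D.γ z) := rfl

theorem γ_twist {e : ZMod 9} {z : R} (hz : D.γ (D.γ (D.γ z)) = D.χ (e + e + e) • z) :
    D.γ (D.twist e z) = D.χ e • D.twist e z := by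
  simp only [twist, map_add, map_smul, smul_add, smul_smul, chi_mul, hz]
  have h1 : -e - e + (e + e + e) = e := by ring
  have h2 : e + -e = 0 := by ring
  have h3 : e + (-e - e) = -e := by ring
  rw [h1, h2, h3, AddChar.map_zero_eq_one, one_smul]
  abel

theorem twist_mem_Inv {d : ℕ} {e : ZMod 9} {z : R} (hd : z ∈ D.L ^ d) (hσ : D.σ z = z)
    (hτ : D.τ z = z) (hz : D.γ (D.γ (D.γ z)) = D.χ (e + e + e) • z) :
    D.twist e z ∈ D.Inv d e := by
  refine ⟨?_, ?_, ?_, γ_twist hz⟩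
  · exact add_mem (add_mem hd (Submodule.smul_mem _ _ (γ_mem_pow hd)))
      (Submodule.smul_mem _ _ (γ_mem_pow (γ_mem_pow hd)))
  · simp [twist, D.σ_γ, D.τ_γ, hσ, hτ]
  · simp [twist, D.σ_γ, D.τ_γ, hσ, hτ]

theorem chi_neg_three : D.χ (-3) = D.χ 3 ^ 2 := by
  rw [← AddChar.map_nsmul_eq_pow]; rfl

theorem chi_neg_six : D.χ (-6) = D.χ 3 := rfl

variable (D) in
/-- The primitive cube root of unity `χ 3`, as an element of `R`. -/
def ω : R := algebraMap F R (D.χ 3)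

theorem ω_rel : D.ω ^ 2 + D.ω + 1 = 0 := by
  have := congrArg (algebraMap F R) D.chi_three
  simpa [ω] using this

/-- The numbers χ(e), χ(e+3), χ(e+6) are the cube roots of χ(3e), so the three twists form the
discrete Fourier transform of (z, χ(-e)γz, χ(-2e)γ²z). -/
theorem twist_add_three (e : ZMod 9) (z : R) : D.twist (e + 3) z =
    z + D.ω ^ 2 * (D.χ (-e) • D.γ z) + D.ω * (D.χ (-e - e) • D.γ (D.γ z)) := by
  have h1 : D.χ (-(e + 3)) = D.χ 3 ^ 2 * D.χ (-e) := by
    rw [← chi_neg_three, chi_mul]; congr 1; ring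
  have h2 : D.χ (-(e + 3) - (e + 3)) = D.χ 3 * D.χ (-e - e) := by
    rw [← chi_neg_six, chi_mul]; congr 1; ring
  rw [twist, h1, h2, mul_smul, mul_smul, Algebra.smul_def (_ ^ 2), Algebra.smul_def (D.χ 3), map_pow]
  rfl

theorem twist_add_six (e : ZMod 9) (z : R) : D.twist (e + 6) z =
    z + D.ω * (D.χ (-e) • D.γ z) + D.ω ^ 2 * (D.χ (-e - e) • D.γ (D.γ z)) := by
  have h1 : D.χ (-(e + 6)) = D.χ 3 * D.χ (-e) := by
    rw [← chi_neg_six, chi_mul]; congr 1; ring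
  have h2 : D.χ (-(e + 6) - (e + 6)) = D.χ 3 ^ 2 * D.χ (-e - e) := by
    rw [← chi_neg_three, chi_mul]; congr 1; ring_nf; congr 1
  rw [twist, h1, h2, mul_smul, mul_smul, Algebra.smul_def (_ ^ 2), Algebra.smul_def (D.χ 3), map_pow]
  rfl

theorem three_smul_eq_sum_twist (e : ZMod 9) (z : R) :
    (3 : F) • z = D.twist e z + D.twist (e + 3) z + D.twist (e + 6) z := by
  rw [twist_add_three, twist_add_six, twist, Algebra.smul_def, map_ofNat]
  linear_combination (-(D.χ (-e) • D.γ z) - (D.χ (-e - e) • D.γ (D.γ z))) * D.ω_rel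

/-- The twist of a product, as a sum of products of twists. -/
theorem three_smul_twist_mul (a : ZMod 9) (x y : R) :
    (3 : F) • D.twist a (x * y) = D.twist 0 x * D.twist a y + D.twist 3 x * D.twist (a + 6) y +
      D.twist 6 x * D.twist (a + 3) y := by
  have h3 := D.twist_add_three 0 x
  have h6 := D.twist_add_six 0 x
  rw [zero_add] at h3 h6
  rw [twist_add_three, twist_add_six, h3, h6]
  simp only [twist, map_mul, Algebra.smul_def, neg_zero, sub_zero, AddChar.map_zero_eq_one, map_one,
    one_mul, map_ofNat]
  generalize algebraMap F R (D.χ (-a)) = p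
  generalize algebraMap F R (D.χ (-a - a)) = q
  generalize D.γ (D.γ x) = x''
  generalize D.γ (D.γ y) = y''
  generalize D.γ x = x'
  generalize D.γ y = y'
  have h := D.ω_rel
  have h' : D.ω ^ 3 = 1 := by linear_combination (D.ω - 1) * h
  have h4 : D.ω ^ 4 = D.ω := by linear_combination D.ω * h'
  generalize D.ω = w at h h' h4
  ring_nf
  simp only [h', h4]
  linear_combination (-(x * p * y' + x * q * y'' + x' * y + x' * q * y'' + x'' * y + x'' * p * y')) * h

/-- Invert the Fourier transform in each variable: the cyclic sum retains only the products Sᵢ Sⱼ Sₖ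
with i + j + k ≡ 0 mod 3. There are nine, and the identity isolates S₀S₀S₀. -/
theorem nine_mul_cyclic_sum {A : Type*} [CommRing A] {w : A} (h : w ^ 2 + w + 1 = 0)
    (a₁ b₁ c₁ a₂ b₂ c₂ a₃ b₃ c₃ : A) :
    let S₀ := fun a b c : A => a + b + c
    let S₁ := fun a b c : A => a + w ^ 2 * b + w * c
    let S₂ := fun a b c : A => a + w * b + w ^ 2 * c
    S₀ a₁ b₁ c₁ * S₀ a₂ b₂ c₂ * S₀ a₃ b₃ c₃ =
      9 * (a₁ * b₂ * c₃ + b₁ * c₂ * a₃ + c₁ * a₂ * b₃) -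
      (w * (S₂ a₁ b₁ c₁ * S₁ a₂ b₂ c₂ * S₀ a₃ b₃ c₃) +
        w ^ 2 * (S₁ a₁ b₁ c₁ * S₂ a₂ b₂ c₂ * S₀ a₃ b₃ c₃) +
        w ^ 2 * (S₂ a₁ b₁ c₁ * S₀ a₂ b₂ c₂ * S₁ a₃ b₃ c₃) +
        w * (S₁ a₁ b₁ c₁ * S₀ a₂ b₂ c₂ * S₂ a₃ b₃ c₃) +
        S₁ a₁ b₁ c₁ * S₁ a₂ b₂ c₂ * S₁ a₃ b₃ c₃ +
        S₂ a₁ b₁ c₁ * S₂ a₂ b₂ c₂ * S₂ a₃ b₃ c₃ +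
        w ^ 2 * (S₀ a₁ b₁ c₁ * S₁ a₂ b₂ c₂ * S₂ a₃ b₃ c₃) +
        w * (S₀ a₁ b₁ c₁ * S₂ a₂ b₂ c₂ * S₁ a₃ b₃ c₃)) := by
  intro S₀ S₁ S₂
  have h2 : w ^ 2 = -w - 1 := by linear_combination h
  have h3 : w ^ 3 = 1 := by linear_combination (w - 1) * h
  have h4 : w ^ 4 = w := by linear_combination w * h3
  have h5 : w ^ 5 = w ^ 2 := by linear_combination w ^ 2 * h3
  have h6 : w ^ 6 = 1 := by linear_combination (w ^ 3 + 1) * h3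
  simp only [S₀, S₁, S₂]
  ring_nf
  simp only [h6, h5, h4, h3, h2]
  ring

end TwistedTetrahedralAction
-- Products of weighted factors
/-- An element of `R` together with a degree and a weight in `ℤ/9`. -/
structure Factor (R : Type*) where
  val : R
  deg : ℕ
  wt : ZMod 9

namespace Factor

variable {R : Type*}

/-- The degree of a multiset of factors. -/
def sumDeg (W : Multiset (Factor R)) : ℕ := (W.map deg).sum

/-- The weight of a multiset of factors. -/
def sumWt (W : Multiset (Factor R)) : ZMod 9 := (W.map wt).sum

@[simp] theorem sumDeg_zero : sumDeg (0 : Multiset (Factor R)) = 0 := rfl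
@[simp] theorem sumWt_zero : sumWt (0 : Multiset (Factor R)) = 0 := rfl
@[simp] theorem sumDeg_cons (a : Factor R) (W : Multiset (Factor R)) :
    sumDeg (a ::ₘ W) = a.deg + sumDeg W := by simp [sumDeg]
@[simp] theorem sumWt_cons (a : Factor R) (W : Multiset (Factor R)) :
    sumWt (a ::ₘ W) = a.wt + sumWt W := by simp [sumWt]
@[simp] theorem sumDeg_add (Y Z : Multiset (Factor R)) :
    sumDeg (Y + Z) = sumDeg Y + sumDeg Z := by simp [sumDeg]
@[simp] theorem sumWt_add (Y Z : Multiset (Factor R)) :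
    sumWt (Y + Z) = sumWt Y + sumWt Z := by simp [sumWt]

theorem sumWt_eq_card_nsmul {e : ZMod 9} {W : Multiset (Factor R)} (h : ∀ a ∈ W, a.wt = e) :
    sumWt W = W.card • e := by
  rw [sumWt, Multiset.map_congr rfl h, Multiset.map_const', Multiset.sum_replicate]

variable [CommRing R]

/-- The product of a multiset of factors. -/
def prodVal (W : Multiset (Factor R)) : R := (W.map val).prod

@[simp] theorem prodVal_zero : prodVal (0 : Multiset (Factor R)) = 1 := rfl
@[simp] theorem prodVal_cons (a : Factor R) (W : Multiset (Factor R)) :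
    prodVal (a ::ₘ W) = a.val * prodVal W := by simp [prodVal]
@[simp] theorem prodVal_add (Y Z : Multiset (Factor R)) :
    prodVal (Y + Z) = prodVal Y * prodVal Z := by simp [prodVal]

end Factor

open Factor

theorem exists_add_eq_of_le_card {α : Type*} {W : Multiset α} {k : ℕ} (h : k ≤ W.card) :
    ∃ Y Z, W = Y + Z ∧ Y.card = k := by
  induction W using Quotient.inductionOn with
  | _ l =>
  refine ⟨(l.take k : List α), (l.drop k : List α), ?_, ?_⟩
  · rw [Multiset.coe_add, List.take_append_drop]; rfl
  · simpa using h

namespace TwistedTetrahedralAction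

variable {F R : Type*} [Field F] [CommRing R] [Algebra F R] {D : TwistedTetrahedralAction F R}

variable (D) in
/-- A factor of positive degree, with `N`-invariant value on which `γ` acts through its weight. -/
def IsFactor (a : Factor R) : Prop := 0 < a.deg ∧ a.val ∈ D.Inv a.deg a.wt

theorem prodVal_mem_Inv {W : Multiset (Factor R)} (hW : ∀ a ∈ W, D.IsFactor a) :
    prodVal W ∈ D.Inv (sumDeg W) (sumWt W) := by
  induction W using Multiset.induction_on with
  | empty => simpa using one_mem_Inv
  | cons a W ih =>
    simp only [prodVal_cons, sumDeg_cons, sumWt_cons]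
    exact mul_mem_Inv (hW a (Multiset.mem_cons_self a W)).2
      (ih fun b hb => hW b (Multiset.mem_cons_of_mem hb))

theorem sumDeg_pos {W : Multiset (Factor R)} (hW : ∀ a ∈ W, D.IsFactor a) (h0 : W ≠ 0) :
    0 < sumDeg W := by
  obtain ⟨a, ha⟩ := Multiset.exists_mem_of_ne_zero h0
  obtain ⟨W, rfl⟩ := Multiset.exists_cons_of_mem ha
  rw [sumDeg_cons]
  exact Nat.add_pos_left (hW a ha).1 _

/-! ### Decomposing zero-sum products -/

section Decompose

variable {d : ℕ} {B : Subalgebra F R} (hB : ∀ i < d, ∀ x ∈ D.Inv i 0, x ∈ B)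

include hB

/-- Factors have positive degree, so both parts are invariants of degree below d. -/
theorem prodVal_mem_of_split {W Y Z : Multiset (Factor R)} (hW : ∀ a ∈ W, D.IsFactor a)
    (hd : sumDeg W = d) (hw : sumWt W = 0) (hYZ : W = Y + Z) (hY : Y ≠ 0) (hZ : Z ≠ 0)
    (hY0 : sumWt Y = 0) : prodVal W ∈ B := by
  subst hYZ
  have hFY : ∀ a ∈ Y, D.IsFactor a := fun a ha => hW a (Multiset.mem_add.2 (.inl ha))
  have hFZ : ∀ a ∈ Z, D.IsFactor a := fun a ha => hW a (Multiset.mem_add.2 (.inr ha))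
  have h1 := sumDeg_pos hFY hY
  have h2 := sumDeg_pos hFZ hZ
  have hZ0 : sumWt Z = 0 := by simpa [hY0] using hw
  rw [sumDeg_add] at hd
  rw [prodVal_add]
  refine mul_mem (hB (sumDeg Y) (by omega) _ ?_) (hB (sumDeg Z) (by omega) _ ?_)
  · simpa [hY0] using prodVal_mem_Inv hFY
  · simpa [hZ0] using prodVal_mem_Inv hFZ

theorem prodVal_mem_of_lt_card {W : Multiset (Factor R)} (hW : ∀ a ∈ W, D.IsFactor a)
    (hd : sumDeg W = d) (hw : sumWt W = 0) (hc : 9 < W.card) : prodVal W ∈ B := by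
  obtain ⟨Y, Z, h, hY, hZ, h0⟩ := exists_zeroSum_split_of_lt_card Factor.wt W hc
  exact prodVal_mem_of_split hB hW hd hw h hY hZ h0

theorem prodVal_mem_of_ne {W : Multiset (Factor R)} (hW : ∀ a ∈ W, D.IsFactor a)
    (hd : sumDeg W = d) (hw : sumWt W = 0) (hc : 9 ≤ W.card) {x y : Factor R} (hx : x ∈ W)
    (hy : y ∈ W) (hxy : x.wt ≠ y.wt) : prodVal W ∈ B := by
  obtain ⟨W, rfl⟩ := Multiset.exists_cons_of_mem hx
  have hy' : y ∈ W := (Multiset.mem_cons.1 hy).resolve_left fun h => hxy (by rw [h])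
  obtain ⟨W, rfl⟩ := Multiset.exists_cons_of_mem hy'
  obtain ⟨Y, Z, h, hY, hZ, h0⟩ := exists_zeroSum_split_of_ne Factor.wt W x y hxy hc
  exact prodVal_mem_of_split hB hW hd hw h hY hZ h0

/-- As 3e ≠ 0, the multiples of 3 in ℤ/9 are 0, -3e and -6e; so p forms a zero-sum part with none,
three or all six elements of X. -/
theorem prodVal_mem_of_six {X : Multiset (Factor R)} {p q : Factor R} {e : ZMod 9}
    (hW : ∀ a ∈ p ::ₘ q ::ₘ X, D.IsFactor a) (hd : sumDeg (p ::ₘ q ::ₘ X) = d)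
    (hw : sumWt (p ::ₘ q ::ₘ X) = 0) (hX : ∀ a ∈ X, a.wt = e) (hc : X.card = 6) (he : 3 * e ≠ 0)
    (hp : 3 * p.wt = 0) : prodVal (p ::ₘ q ::ₘ X) ∈ B := by
  have key : ∀ e h : ZMod 9, 3 * e ≠ 0 → 3 * h = 0 → h = 0 ∨ h + 3 * e = 0 ∨ h + 6 * e = 0 := by
    decide
  rcases key e p.wt he hp with h | h | h
  · exact prodVal_mem_of_split (Y := {p}) (Z := q ::ₘ X) hB hW hd hw
      (Multiset.singleton_add _ _).symm (by simp) (by simp)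
      (by simpa [sumWt] using h)
  · obtain ⟨Y, Z, rfl, hY⟩ := exists_add_eq_of_le_card (W := X) (k := 3) (by omega)
    refine prodVal_mem_of_split (Y := p ::ₘ Y) (Z := q ::ₘ Z) hB hW hd hw ?_ (by simp) (by simp) ?_
    · simp only [← Multiset.singleton_add]; abel
    · rw [sumWt_cons, sumWt_eq_card_nsmul fun a ha => hX a (Multiset.mem_add.2 (.inl ha)), hY]
      simpa using h
  · refine prodVal_mem_of_split (Y := p ::ₘ X) (Z := {q}) hB hW hd hw ?_ (by simp) (by simp) ?_
    · simp only [← Multiset.singleton_add]; abel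
    · rw [sumWt_cons, sumWt_eq_card_nsmul hX, hc]
      simpa using h

end Decompose

variable (D) in
/-- Linear forms of the `N`-weight `(1, -1)` on which `γ³` acts as `χ c`, where `3 c = 0`. -/
structure IsLetter (c : ZMod 9) (u : R) : Prop where
  mem : u ∈ D.L
  σ_eq : D.σ u = u
  τ_eq : D.τ u = -u
  γ_eq : D.γ (D.γ (D.γ u)) = D.χ c • u
  three_mul : 3 * c = 0

variable (D) in
/-- `N`-invariants of degree `d` on which `γ³` acts as `χ c`. -/
structure IsCubeEigen (d : ℕ) (c : ZMod 9) (z : R) : Prop where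
  mem : z ∈ D.L ^ d
  σ_eq : D.σ z = z
  τ_eq : D.τ z = z
  γ_eq : D.γ (D.γ (D.γ z)) = D.χ c • z

theorem IsCubeEigen.twist_mem {d : ℕ} {c e : ZMod 9} {z : R} (hz : D.IsCubeEigen d c z)
    (he : 3 * e = c) : D.twist e z ∈ D.Inv d e :=
  twist_mem_Inv hz.mem hz.σ_eq hz.τ_eq (by rw [hz.γ_eq, ← he]; congr 2; ring)

theorem IsLetter.mul {c c' : ZMod 9} {u v : R} (hu : D.IsLetter c u) (hv : D.IsLetter c' v) :
    D.IsCubeEigen 2 (c + c') (u * v) where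
  mem := by rw [pow_two]; exact Submodule.mul_mem_mul hu.mem hv.mem
  σ_eq := by rw [map_mul, hu.σ_eq, hv.σ_eq]
  τ_eq := by rw [map_mul, hu.τ_eq, hv.τ_eq, neg_mul_neg]
  γ_eq := by simp only [map_mul, hu.γ_eq, hv.γ_eq, smul_mul_smul_comm, chi_mul]

theorem IsLetter.mul_mul {c₁ c₂ c₃ : ZMod 9} {u v w : R} (hu : D.IsLetter c₁ u)
    (hv : D.IsLetter c₂ v) (hw : D.IsLetter c₃ w) :
    D.IsCubeEigen 3 (c₁ + c₂ + c₃) (u * D.γ v * D.γ (D.γ w)) where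
  mem := by
    rw [pow_succ, pow_two]
    exact Submodule.mul_mem_mul (Submodule.mul_mem_mul hu.mem (D.γ_mem _ hv.mem))
      (D.γ_mem _ (D.γ_mem _ hw.mem))
  σ_eq := by simp [D.σ_γ, D.τ_γ, hu.σ_eq, hw.σ_eq, hv.τ_eq, hw.τ_eq]
  τ_eq := by simp [D.σ_γ, D.τ_γ, hv.σ_eq, hw.σ_eq, hu.τ_eq, hv.τ_eq, hw.τ_eq]
  γ_eq := by
    simp only [map_mul, hu.γ_eq, hv.γ_eq, hw.γ_eq, smul_mul_smul_comm, chi_mul, map_smul]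

/-- The three terms are the γ-translates of w₁·γw₂·γ²w₃; each γ³ that appears on w₂ or w₃ becomes
the scalar χ(3e). -/
theorem cyclic_sum_eq_twist {e : ZMod 9} {w₁ w₂ w₃ : R}
    (h₂ : D.γ (D.γ (D.γ w₂)) = D.χ (3 * e) • w₂)
    (h₃ : D.γ (D.γ (D.γ w₃)) = D.χ (3 * e) • w₃) :
    w₁ * (D.χ (-e) • D.γ w₂) * (D.χ (-e - e) • D.γ (D.γ w₃)) +
      (D.χ (-e) • D.γ w₁) * (D.χ (-e - e) • D.γ (D.γ w₂)) * w₃ +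
      (D.χ (-e - e) • D.γ (D.γ w₁)) * w₂ * (D.χ (-e) • D.γ w₃) =
    D.χ (-(3 * e)) • D.twist (3 * e) (w₁ * D.γ w₂ * D.γ (D.γ w₃)) := by
  have hz : D.χ (-(3 * e)) * D.χ (3 * e) = 1 := by
    rw [chi_mul, neg_add_cancel, AddChar.map_zero_eq_one]
  have h3 : D.χ (-(3 * e)) = D.χ (-e) * D.χ (-e - e) := by rw [chi_mul]; congr 1; ring
  have h6 : D.χ (-(3 * e) - 3 * e) = D.χ (-(3 * e)) * D.χ (-(3 * e)) := by rw [chi_mul, sub_eq_add_neg]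
  simp only [twist, map_mul, h₂, h₃, map_smul, h6]
  rw [h3] at hz ⊢
  simp only [Algebra.smul_def, map_mul]
  have hz' := congrArg (algebraMap F R) hz
  simp only [map_mul, map_one] at hz'
  generalize algebraMap F R (D.χ (-e)) = p at *
  generalize algebraMap F R (D.χ (-e - e)) = q at *
  generalize algebraMap F R (D.χ (3 * e)) = r at *
  generalize D.γ (D.γ w₁) = x1
  generalize D.γ (D.γ w₂) = x2
  generalize D.γ (D.γ w₃) = x3
  generalize D.γ w₁ = y1
  generalize D.γ w₂ = y2
  generalize D.γ w₃ = y3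
  linear_combination (-p * q * y1 * x2 * w₃ - p * q * (p * q * r + 1) * x1 * w₂ * y3) * hz'

/-! ### Factors of equal weight and the degree 18 bound -/

section Decompose

variable {d : ℕ} {B : Subalgebra F R} (hB : ∀ i < d, ∀ x ∈ D.Inv i 0, x ∈ B)

include hB

/-- Expanding the twist of UV gives products of a twist of U and a twist of V, both with weights in
{0, 3, 6}; each is split off with the help of X. -/
theorem mul_twist_mem {X : Multiset (Factor R)} {e : ZMod 9} {U V : R}
    (hX : ∀ a ∈ X, D.IsFactor a) (hXe : ∀ a ∈ X, a.wt = e) (hc : X.card = 6) (he : 3 * e ≠ 0)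
    (hd : sumDeg X + 6 = d) (hU : D.IsCubeEigen 3 0 U) (hV : D.IsCubeEigen 3 0 V) :
    prodVal X * D.twist (3 * e) (U * V) ∈ B := by
  have key : ∀ a b : ZMod 9, 3 * a = 0 → 3 * b = 0 → a + b = 3 * e →
      prodVal X * (D.twist a U * D.twist b V) ∈ B := by
    intro a b ha hb hab
    have := prodVal_mem_of_six (X := X) (p := ⟨D.twist a U, 3, a⟩) (q := ⟨D.twist b V, 3, b⟩) hB
      ?_ ?_ ?_ hXe hc he ha
    · simp only [prodVal_cons] at this
      convert this using 1
      ring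
    · simp only [Multiset.forall_mem_cons]
      exact ⟨⟨by norm_num, hU.twist_mem ha⟩, ⟨by norm_num, hV.twist_mem hb⟩, hX⟩
    · simp only [sumDeg_cons]; omega
    · simp only [sumWt_cons]
      rw [sumWt_eq_card_nsmul hXe, hc, ← add_assoc, hab, nsmul_eq_mul]
      have : ∀ e : ZMod 9, 3 * e + (6 : ℕ) * e = 0 := by decide
      exact this e
  have h3 : ∀ e : ZMod 9, 3 * (3 * e) = 0 ∧ 3 * (3 * e + 6) = 0 ∧ 3 * (3 * e + 3) = 0 ∧
      3 + (3 * e + 6) = 3 * e ∧ 6 + (3 * e + 3) = 3 * e := by decide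
  obtain ⟨k1, k2, k3, k4, k5⟩ := h3 e
  have : (3 : F) • (prodVal X * D.twist (3 * e) (U * V)) ∈ B := by
    rw [← mul_smul_comm, three_smul_twist_mul, mul_add, mul_add]
    exact add_mem (add_mem (key _ _ (by decide) k1 (by ring)) (key _ _ (by decide) k2 k4))
      (key _ _ (by decide) k3 k5)
  have := B.smul_mem this (3 : F)⁻¹
  rwa [smul_smul, inv_mul_cancel₀ D.three_ne_zero, one_smul] at this

theorem mul_three_twist_mem {X : Multiset (Factor R)} {e c : ZMod 9} {u v : Fin 3 → R}
    (hX : ∀ a ∈ X, D.IsFactor a) (hXe : ∀ a ∈ X, a.wt = e) (hc : X.card = 6) (he : 3 * e ≠ 0)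
    (hd : sumDeg X + 6 = d) (hu : ∀ i, D.IsLetter c (u i)) (hv : ∀ i, D.IsLetter (3 * e - c) (v i)) :
    prodVal X * (D.twist e (u 0 * v 0) * D.twist e (u 1 * v 1) * D.twist e (u 2 * v 2)) ∈ B := by
  have hw : ∀ i, D.IsCubeEigen 2 (3 * e) (u i * v i) := fun i => by
    have := (hu i).mul (hv i)
    rwa [add_sub_cancel] at this
  set w : Fin 3 → R := fun i => u i * v i
  have hU : D.IsCubeEigen 3 0 (u 0 * D.γ (u 1) * D.γ (D.γ (u 2))) := by
    have := (hu 0).mul_mul (hu 1) (hu 2)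
    rwa [show c + c + c = 3 * c by ring, (hu 0).three_mul] at this
  have hV : D.IsCubeEigen 3 0 (v 0 * D.γ (v 1) * D.γ (D.γ (v 2))) := by
    have := (hv 0).mul_mul (hv 1) (hv 2)
    rwa [← (hv 0).three_mul, show 3 * (3 * e - c) = (3 * e - c) + (3 * e - c) + (3 * e - c) by ring]
  -- Once a weight differs from e, the nine weights are not all equal, so the product splits.
  have key : ∀ e₁ e₂ e₃ : ZMod 9, 3 * e₁ = 3 * e → 3 * e₂ = 3 * e → 3 * e₃ = 3 * e →
      e₁ + e₂ + e₃ = 3 * e → e₁ ≠ e ∨ e₂ ≠ e →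
      prodVal X * (D.twist e₁ (w 0) * D.twist e₂ (w 1) * D.twist e₃ (w 2)) ∈ B := by
    intro e₁ e₂ e₃ h₁ h₂ h₃ hs hne
    obtain ⟨x, hx⟩ : ∃ x, x ∈ X := Multiset.card_pos_iff_exists_mem.1 (by omega)
    have hxm : x ∈ (⟨D.twist e₁ (w 0), 2, e₁⟩ ::ₘ ⟨D.twist e₂ (w 1), 2, e₂⟩ ::ₘ
      ⟨D.twist e₃ (w 2), 2, e₃⟩ ::ₘ X : Multiset (Factor R)) := by simp [hx]
    obtain ⟨y, hy, hxy⟩ : ∃ y ∈ (⟨D.twist e₁ (w 0), 2, e₁⟩ ::ₘ ⟨D.twist e₂ (w 1), 2, e₂⟩ ::ₘ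
      ⟨D.twist e₃ (w 2), 2, e₃⟩ ::ₘ X : Multiset (Factor R)), x.wt ≠ y.wt := by
      rw [hXe x hx]
      rcases hne with h | h
      · exact ⟨⟨D.twist e₁ (w 0), 2, e₁⟩, by simp, h.symm⟩
      · exact ⟨⟨D.twist e₂ (w 1), 2, e₂⟩, by simp, h.symm⟩
    have := prodVal_mem_of_ne hB ?_ ?_ ?_ ?_ hxm hy hxy
    · simp only [prodVal_cons] at this
      convert this using 1
      ring
    · simp only [Multiset.forall_mem_cons]
      exact ⟨⟨by norm_num, (hw 0).twist_mem h₁⟩, ⟨by norm_num, (hw 1).twist_mem h₂⟩,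
        ⟨by norm_num, (hw 2).twist_mem h₃⟩, hX⟩
    · simp only [sumDeg_cons]; omega
    · simp only [sumWt_cons]
      rw [sumWt_eq_card_nsmul hXe, hc, ← add_assoc, ← add_assoc, hs, nsmul_eq_mul]
      have : ∀ e : ZMod 9, 3 * e + (6 : ℕ) * e = 0 := by decide
      exact this e
    · simp [hc]
  have hO := mul_twist_mem hB hX hXe hc he hd hU hV
  -- The regrouping that separates the u's from the v's; equal γ³-eigenvalues make both cubics
  -- γ³-fixed.
  have hUV : u 0 * D.γ (u 1) * D.γ (D.γ (u 2)) * (v 0 * D.γ (v 1) * D.γ (D.γ (v 2))) =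
      w 0 * D.γ (w 1) * D.γ (D.γ (w 2)) := by
    simp only [w, map_mul]; ring
  rw [hUV] at hO
  replace hO := B.smul_mem hO (D.χ (-(3 * e)))
  rw [← mul_smul_comm, ← cyclic_sum_eq_twist (hw 1).γ_eq (hw 2).γ_eq] at hO
  have hid := nine_mul_cyclic_sum D.ω_rel (w 0) (D.χ (-e) • D.γ (w 0))
    (D.χ (-e - e) • D.γ (D.γ (w 0))) (w 1) (D.χ (-e) • D.γ (w 1))
    (D.χ (-e - e) • D.γ (D.γ (w 1))) (w 2) (D.χ (-e) • D.γ (w 2))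
    (D.χ (-e - e) • D.γ (D.γ (w 2)))
  simp only [← twist_add_three, ← twist_add_six, ← twist_eq] at hid
  have hω : D.ω ∈ B := B.algebraMap_mem _
  have hω2 : D.ω ^ 2 ∈ B := pow_mem hω 2
  have h9 : (9 : R) ∈ B := B.natCast_mem 9
  have e0 : ∀ e : ZMod 9, 3 * (e + 3) = 3 * e ∧ 3 * (e + 6) = 3 * e ∧ e + 3 ≠ e ∧ e + 6 ≠ e ∧
      e + 6 + (e + 3) + e = 3 * e ∧ e + 3 + (e + 6) + e = 3 * e ∧ e + 6 + e + (e + 3) = 3 * e ∧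
      e + 3 + e + (e + 6) = 3 * e ∧ e + 3 + (e + 3) + (e + 3) = 3 * e ∧
      e + 6 + (e + 6) + (e + 6) = 3 * e ∧ e + (e + 3) + (e + 6) = 3 * e ∧
      e + (e + 6) + (e + 3) = 3 * e := by decide
  obtain ⟨a3, a6, n3, n6, s1, s2, s3, s4, s5, s6, s7, s8⟩ := e0 e
  have m1 := mul_mem hω (key _ _ _ a6 a3 rfl s1 (.inl n6))
  have m2 := mul_mem hω2 (key _ _ _ a3 a6 rfl s2 (.inl n3))
  have m3 := mul_mem hω2 (key _ _ _ a6 rfl a3 s3 (.inl n6))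
  have m4 := mul_mem hω (key _ _ _ a3 rfl a6 s4 (.inl n3))
  have m5 := key _ _ _ a3 a3 a3 s5 (.inl n3)
  have m6 := key _ _ _ a6 a6 a6 s6 (.inl n6)
  have m7 := mul_mem hω2 (key _ _ _ rfl a3 a6 s7 (.inr n3))
  have m8 := mul_mem hω (key _ _ _ rfl a6 a3 s8 (.inr n6))
  have := sub_mem (mul_mem h9 hO) (add_mem (add_mem (add_mem (add_mem (add_mem (add_mem
    (add_mem m1 m2) m3) m4) m5) m6) m7) m8)
  convert this using 1
  change prodVal X * (D.twist e (w 0) * D.twist e (w 1) * D.twist e (w 2)) = _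
  rw [hid]
  ring

variable (D) in
omit hB in
/-- Degree-one factors. -/
def IsLinear (a : Factor R) : Prop := a.deg = 1 ∧ D.IsFactor a

variable (D) in
omit hB in
/-- Twists of products of two letters. -/
def IsQuad (c : ZMod 9) (a : Factor R) : Prop :=
  a.deg = 2 ∧ ∃ u v, D.IsLetter c u ∧ D.IsLetter (3 * a.wt - c) v ∧ a.val = D.twist a.wt (u * v)

omit hB in
theorem IsQuad.isFactor {c : ZMod 9} {a : Factor R} (h : D.IsQuad c a) : D.IsFactor a := by
  obtain ⟨hd, u, v, hu, hv, ha⟩ := h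
  refine ⟨by omega, ?_⟩
  rw [ha, hd]
  exact (hu.mul hv).twist_mem (by ring)

theorem prodVal_mem_of_three_quads {X Q : Multiset (Factor R)} {e c : ZMod 9}
    (hX : ∀ a ∈ X, D.IsFactor a) (hXe : ∀ a ∈ X, a.wt = e) (hc : X.card = 6) (he : 3 * e ≠ 0)
    (hQ : ∀ a ∈ Q, D.IsQuad c a) (hQe : ∀ a ∈ Q, a.wt = e) (hQc : Q.card = 3)
    (hd : sumDeg X + sumDeg Q = d) : prodVal X * prodVal Q ∈ B := by
  obtain ⟨q₁, q₂, q₃, rfl⟩ := Multiset.card_eq_three.1 hQc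
  simp only [Multiset.insert_eq_cons, Multiset.mem_cons, Multiset.mem_singleton, forall_eq_or_imp,
    forall_eq] at hQ hQe
  obtain ⟨⟨d₁, u₁, v₁, hu₁, hv₁, h₁⟩, ⟨d₂, u₂, v₂, hu₂, hv₂, h₂⟩, ⟨d₃, u₃, v₃, hu₃, hv₃, h₃⟩⟩ := hQ
  obtain ⟨e₁, e₂, e₃⟩ := hQe
  rw [e₁] at h₁ hv₁
  rw [e₂] at h₂ hv₂
  rw [e₃] at h₃ hv₃
  have hd' : sumDeg X + 6 = d := by
    rw [← hd]; simp [sumDeg, d₁, d₂, d₃]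
  have := mul_three_twist_mem (u := ![u₁, u₂, u₃]) (v := ![v₁, v₂, v₃]) hB hX hXe hc he hd'
    (by intro i; fin_cases i <;> assumption) (by intro i; fin_cases i <;> assumption)
  simpa [prodVal, h₁, h₂, h₃, mul_assoc] using this

/-- The key decomposition: products of linear and quadratic factors and at most one further factor,
of degree at most three, are decomposable in degrees at least 18. -/
theorem prodVal_mem_of_le {K Q C : Multiset (Factor R)} (hK : ∀ a ∈ K, D.IsLinear a)
    (hQ : ∀ a ∈ Q, ∃ c, D.IsQuad c a) (hC : ∀ a ∈ C, D.IsFactor a ∧ a.deg = 3) (hC1 : C.card ≤ 1)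
    (hd : sumDeg (K + Q + C) = d) (hw : sumWt (K + Q + C) = 0) (h18 : 18 ≤ d) :
    prodVal (K + Q + C) ∈ B := by
  classical
  have hF : ∀ a ∈ K + Q + C, D.IsFactor a := by
    intro a ha
    simp only [Multiset.mem_add] at ha
    rcases ha with (h | h) | h
    · exact (hK a h).2
    · exact (hQ a h).choose_spec.isFactor
    · exact (hC a h).1
  by_cases h10 : 9 < (K + Q + C).card
  · exact prodVal_mem_of_lt_card hB hF hd hw h10
  have dK : sumDeg K = K.card := by
    rw [sumDeg, Multiset.map_congr rfl fun a ha => (hK a ha).1]; simp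
  have dQ : sumDeg Q = Q.card * 2 := by
    rw [sumDeg, Multiset.map_congr rfl fun a ha => (hQ a ha).choose_spec.1]; simp
  have dC : sumDeg C = C.card * 3 := by
    rw [sumDeg, Multiset.map_congr rfl fun a ha => (hC a ha).2]; simp
  have hd2 := hd
  simp only [sumDeg_add, dK, dQ, dC] at hd2
  simp only [Multiset.card_add] at h10
  -- Eight factors, at most one of them cubic, have degree at most 17. With nine, degree at least 18
  -- forces `K.card ≤ C.card ≤ 1`.
  have h9 : (K + Q + C).card = 9 := by simp only [Multiset.card_add]; omega
  have h7 : 7 ≤ Q.card := by omega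
  by_cases hne : ∃ x ∈ K + Q + C, ∃ y ∈ K + Q + C, x.wt ≠ y.wt
  · obtain ⟨x, hx, y, hy, hxy⟩ := hne
    exact prodVal_mem_of_ne hB hF hd hw h9.ge hx hy hxy
  push Not at hne
  obtain ⟨x, hx⟩ : ∃ x, x ∈ K + Q + C := Multiset.card_pos_iff_exists_mem.1 (by omega)
  have hwt : ∀ a ∈ K + Q + C, a.wt = x.wt := fun a ha => hne a ha x hx
  -- If the common weight is not a generator of ℤ/9, any three factors already sum to zero.
  by_cases he : 3 * x.wt = 0
  · obtain ⟨Y, Z, hYZ, hY⟩ := exists_add_eq_of_le_card (W := K + Q + C) (k := 3) (by omega)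
    refine prodVal_mem_of_split hB hF hd hw hYZ (by rintro rfl; simp at hY) ?_ ?_
    · rintro rfl
      rw [hYZ, add_zero] at h9
      omega
    · rw [sumWt_eq_card_nsmul fun a ha => hwt a (hYZ ▸ Multiset.mem_add.2 (.inl ha)), hY]
      simpa using he
  have hc3 : ∀ c : ZMod 9, 3 * c = 0 → ∃ i : Fin 3, c = ![0, 3, 6] i := by decide
  obtain ⟨i, hi⟩ := exists_three_le_card_filter Q (fun i => D.IsQuad (![0, 3, 6] i)) (by
    intro a ha
    obtain ⟨c, hc⟩ := hQ a ha
    have hc' := hc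
    obtain ⟨-, u, v, hu, -⟩ := hc'
    obtain ⟨i, rfl⟩ := hc3 c hu.three_mul
    exact ⟨i, hc⟩) h7
  obtain ⟨Y, Z, hYZ, hY⟩ := exists_add_eq_of_le_card hi
  have hY' : ∀ a ∈ Y, D.IsQuad (![0, 3, 6] i) a := fun a ha =>
    (Multiset.mem_filter.1 (hYZ ▸ Multiset.mem_add.2 (.inl ha))).2
  obtain ⟨Q', hQ'⟩ := Multiset.le_iff_exists_add.1
    ((Multiset.le_iff_exists_add.2 ⟨Z, hYZ⟩).trans (Multiset.filter_le _ Q))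
  have hsplit : K + Q + C = (K + Q' + C) + Y := by rw [hQ']; abel
  rw [hsplit] at h9 hF hwt hd ⊢
  rw [prodVal_add]
  refine prodVal_mem_of_three_quads (e := x.wt) hB (fun a ha => hF a (Multiset.mem_add.2 (.inl ha)))
    (fun a ha => hwt a (Multiset.mem_add.2 (.inl ha))) ?_ he hY'
    (fun a ha => hwt a (Multiset.mem_add.2 (.inr ha))) hY ?_
  · rw [Multiset.card_add] at h9
    omega
  · rw [← hd]
    simp only [sumDeg_add]

end Decompose

/-! ### Spanning sets for linear forms and their powers -/

theorem mem_of_three_smul_mem (D : TwistedTetrahedralAction F R) {S : Submodule F R} {x : R}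
    (h : (3 : F) • x ∈ S) : x ∈ S :=
  (S.smul_mem_iff D.three_ne_zero).1 h

variable (D) in
/-- Three times the projection to the `χ c`-eigenspace of `γ³`. -/
def cube (c : ZMod 9) (x : R) : R :=
  x + D.χ (-c) • D.γ (D.γ (D.γ x)) + D.χ (-c - c) • D.γ (D.γ (D.γ (D.γ (D.γ (D.γ x)))))

theorem γ_cube {c : ZMod 9} (hc : 3 * c = 0) (x : R) :
    D.γ (D.γ (D.γ (D.cube c x))) = D.χ c • D.cube c x := by
  simp only [cube, map_add, map_smul, smul_add, smul_smul, chi_mul, D.γ_nine]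
  have h1 : -c - c = c := by linear_combination -hc
  have h2 : c + -c = 0 := by ring
  have h3 : c + c = -c := by linear_combination hc
  rw [h1, h2, h3, AddChar.map_zero_eq_one, one_smul]
  abel

theorem three_smul_eq_sum_cube (x : R) :
    (3 : F) • x = D.cube 0 x + D.cube 3 x + D.cube 6 x := by
  have h3 : D.χ (-3 - 3) = D.χ 3 := rfl
  have h4 : D.χ (-6 - 6) = D.χ 3 ^ 2 := by rw [← chi_neg_three]; rfl
  simp only [cube, neg_zero, sub_zero, AddChar.map_zero_eq_one, h3, h4, chi_neg_three, chi_neg_six]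
  generalize D.γ (D.γ (D.γ (D.γ (D.γ (D.γ x))))) = z
  generalize D.γ (D.γ (D.γ x)) = y
  have h : D.χ 3 ^ 2 = -D.χ 3 - 1 := by linear_combination D.chi_three
  rw [h]
  module

variable (D) in
/-- Degree-one `N`-invariant eigenvectors of `γ`, and the rotations of letters. -/
def basicForms : Set R :=
  {y | ∃ e, y ∈ D.Inv 1 e} ∪ {x | ∃ c u, ∃ k : Fin 3, D.IsLetter c u ∧ x = (D.γ ^ (k : ℕ)) u}

theorem mem_span_of_σ_eq_of_τ_eq_neg {x : R} (hx : x ∈ D.L) (hσ : D.σ x = x) (hτ : D.τ x = -x)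
    (k : Fin 3) : (D.γ ^ (k : ℕ)) x ∈ Submodule.span F D.basicForms := by
  have key : ∀ c : ZMod 9, 3 * c = 0 →
      (D.γ ^ (k : ℕ)) (D.cube c x) ∈ Submodule.span F D.basicForms := by
    intro c hc
    refine Submodule.subset_span (.inr ⟨c, _, k, ⟨?_, ?_, ?_, γ_cube hc x, hc⟩, rfl⟩)
    · have h3 := fun y hy => D.γ_mem _ (D.γ_mem _ (D.γ_mem y hy))
      exact add_mem (add_mem hx (D.L.smul_mem _ (h3 x hx))) (D.L.smul_mem _ (h3 _ (h3 x hx)))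
    · simp [cube, D.σ_γ, D.τ_γ, hσ, hτ]
    · simp [cube, D.σ_γ, D.τ_γ, hσ, hτ]
      abel
  refine mem_of_three_smul_mem (D := D) ?_
  rw [← map_smul, three_smul_eq_sum_cube, map_add, map_add]
  exact add_mem (add_mem (key 0 (by decide)) (key 3 (by decide))) (key 6 (by decide))

theorem mem_span_of_σ_eq_of_τ_eq {x : R} (hx : x ∈ D.L) (hσ : D.σ x = x) (hτ : D.τ x = x) :
    x ∈ Submodule.span F D.basicForms := by
  have key : ∀ c e : ZMod 9, 3 * e = c → 3 * c = 0 →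
      D.twist e (D.cube c x) ∈ Submodule.span F D.basicForms := by
    rintro c e he hc
    refine Submodule.subset_span (.inl ⟨e, IsCubeEigen.twist_mem (c := c) ⟨?_, ?_, ?_, γ_cube hc x⟩ he⟩)
    · have h3 := fun y hy => D.γ_mem _ (D.γ_mem _ (D.γ_mem y hy))
      rw [pow_one]
      exact add_mem (add_mem hx (D.L.smul_mem _ (h3 x hx))) (D.L.smul_mem _ (h3 _ (h3 x hx)))
    · simp [cube, D.σ_γ, D.τ_γ, hσ, hτ]
    · simp [cube, D.σ_γ, D.τ_γ, hσ, hτ]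
  have key' : ∀ c e : ZMod 9, 3 * e = c → 3 * c = 0 →
      D.cube c x ∈ Submodule.span F D.basicForms := by
    intro c e he hc
    refine mem_of_three_smul_mem (D := D) ?_
    rw [three_smul_eq_sum_twist e]
    have h : ∀ e : ZMod 9, 3 * (e + 3) = 3 * e ∧ 3 * (e + 6) = 3 * e := by decide
    exact add_mem (add_mem (key c _ he hc) (key c _ ((h e).1.trans he) hc))
      (key c _ ((h e).2.trans he) hc)
  refine mem_of_three_smul_mem (D := D) ?_
  rw [three_smul_eq_sum_cube]
  exact add_mem (add_mem (key' 0 0 (by decide) (by decide)) (key' 3 1 (by decide) (by decide)))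
    (key' 6 2 (by decide) (by decide))

theorem L_le_span_basicForms : D.L ≤ Submodule.span F D.basicForms := by
  intro x hx
  have hs := D.σ_mem x hx
  have ht := D.τ_mem x hx
  have hst := D.σ_mem _ ht
  have h8 : ∀ y ∈ D.L, D.γ (D.γ (D.γ (D.γ (D.γ (D.γ (D.γ y)))))) ∈ D.L := fun y hy =>
    D.γ_mem _ (D.γ_mem _ (D.γ_mem _ (D.γ_mem _ (D.γ_mem _ (D.γ_mem _ (D.γ_mem _ hy))))))
  have hA : x + D.σ x + D.τ x + D.σ (D.τ x) ∈ Submodule.span F D.basicForms := by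
    refine mem_span_of_σ_eq_of_τ_eq (add_mem (add_mem (add_mem hx hs) ht) hst) ?_ ?_
    · simp only [map_add, D.σ_σ]; abel
    · simp only [map_add, D.σ_τ, D.τ_τ]; abel
  have hB : x + D.σ x - D.τ x - D.σ (D.τ x) ∈ Submodule.span F D.basicForms := by
    refine mem_span_of_σ_eq_of_τ_eq_neg (sub_mem (sub_mem (add_mem hx hs) ht) hst) ?_ ?_ 0
    · simp only [map_add, map_sub, D.σ_σ]; abel
    · simp only [map_add, map_sub, D.σ_τ, D.τ_τ]; abel
  have hC : x - D.σ x + D.τ x - D.σ (D.τ x) ∈ Submodule.span F D.basicForms := by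
    have hy : x - D.σ x + D.τ x - D.σ (D.τ x) ∈ D.L := sub_mem (add_mem (sub_mem hx hs) ht) hst
    have hσ : D.σ (x - D.σ x + D.τ x - D.σ (D.τ x)) = -(x - D.σ x + D.τ x - D.σ (D.τ x)) := by
      simp only [map_add, map_sub, D.σ_σ]; abel
    have hτ : D.τ (x - D.σ x + D.τ x - D.σ (D.τ x)) = x - D.σ x + D.τ x - D.σ (D.τ x) := by
      simp only [map_add, map_sub, D.σ_τ, D.τ_τ]; abel
    generalize x - D.σ x + D.τ x - D.σ (D.τ x) = y at *
    -- A form of weight (-1, 1) is γ² of γ⁷y, which has the letters' weight (1, -1).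
    have := mem_span_of_σ_eq_of_τ_eq_neg (h8 y hy) (by simp [D.σ_γ, D.τ_γ, hσ, hτ])
      (by simp [D.σ_γ, D.τ_γ, hσ, hτ]) 2
    simpa [pow_two, D.γ_nine] using this
  have hE : x - D.σ x - D.τ x + D.σ (D.τ x) ∈ Submodule.span F D.basicForms := by
    have hy : x - D.σ x - D.τ x + D.σ (D.τ x) ∈ D.L := add_mem (sub_mem (sub_mem hx hs) ht) hst
    have hσ : D.σ (x - D.σ x - D.τ x + D.σ (D.τ x)) = -(x - D.σ x - D.τ x + D.σ (D.τ x)) := by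
      simp only [map_add, map_sub, D.σ_σ]; abel
    have hτ : D.τ (x - D.σ x - D.τ x + D.σ (D.τ x)) = -(x - D.σ x - D.τ x + D.σ (D.τ x)) := by
      simp only [map_add, map_sub, D.σ_τ, D.τ_τ]; abel
    generalize x - D.σ x - D.τ x + D.σ (D.τ x) = y at *
    have := mem_span_of_σ_eq_of_τ_eq_neg (D.γ_mem _ (h8 y hy))
      (by simp [D.σ_γ, D.τ_γ, hσ, hτ])
      (by simp [D.σ_γ, D.τ_γ, hσ, hτ]) 1
    simpa [D.γ_nine] using this
  -- The four unnormalised projections to the characters of N add up to 4x.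
  have h4 : (4 : F) ≠ 0 := by
    rw [show (4 : F) = 2 * 2 by norm_num]
    exact mul_ne_zero D.two_ne_zero D.two_ne_zero
  refine (Submodule.smul_mem_iff _ h4).1 ?_
  have := add_mem (add_mem (add_mem hA hB) hC) hE
  convert this using 1
  module

variable (D) in
/-- Products of linear and quadratic factors and a square-free product of rotated letters. -/
def standardProducts (d : ℕ) : Set R :=
  {f | ∃ (K Q : Multiset (Factor R)) (s : Finset (Fin 3)) (u : Fin 3 → R),
    (∀ a ∈ K, D.IsLinear a) ∧ (∀ a ∈ Q, ∃ c, D.IsQuad c a) ∧ (∀ k, ∃ c, D.IsLetter c (u k)) ∧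
    sumDeg (K + Q) + s.card = d ∧ f = prodVal (K + Q) * ∏ k ∈ s, (D.γ ^ (k : ℕ)) (u k)}

theorem exists_three_mul_eq {c : ZMod 9} (hc : 3 * c = 0) : ∃ e, 3 * e = c := by
  revert c; decide

theorem rotate_twist (k : Fin 3) {c e : ZMod 9} {d : ℕ} {z : R} (hz : D.IsCubeEigen d c z)
    (he : 3 * e = c) : (D.γ ^ (k : ℕ)) (D.twist e z) = D.χ e ^ (k : ℕ) • D.twist e z := by
  have h := (hz.twist_mem he).2.2.2
  generalize (k : ℕ) = n
  induction n with
  | zero => simp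
  | succ n ih => rw [pow_succ', AlgHom.mul_apply, ih, map_smul, h, smul_smul, pow_succ]

/-- A new rotated letter either fills an unused rotation or pairs with the letter already there. In
the second case γᵏ acts on each twist of the pair by a scalar, so the rotation disappears. -/
theorem mul_mem_span_standardProducts {d : ℕ} {f x : R} (hf : f ∈ D.standardProducts d)
    (hx : x ∈ D.basicForms) : f * x ∈ Submodule.span F (D.standardProducts (d + 1)) := by
  obtain ⟨K, Q, s, u, hK, hQ, hu, hd, rfl⟩ := hf
  rcases hx with ⟨e, hy⟩ | ⟨c, v, k, hv, rfl⟩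
  · refine Submodule.subset_span ⟨⟨x, 1, e⟩ ::ₘ K, Q, s, u, ?_, hQ, hu, ?_, ?_⟩
    · simp only [Multiset.forall_mem_cons]
      exact ⟨⟨rfl, Nat.one_pos, hy⟩, hK⟩
    · rw [Multiset.cons_add, sumDeg_cons, ← hd]; ring
    · rw [Multiset.cons_add, prodVal_cons]; ring
  by_cases hk : k ∈ s
  · obtain ⟨c', hc'⟩ := hu k
    have hz := hc'.mul hv
    obtain ⟨e, he⟩ := exists_three_mul_eq (c := c' + c) (by
      rw [mul_add, hc'.three_mul, hv.three_mul, add_zero])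
    have key : ∀ e, 3 * e = c' + c →
        prodVal (K + Q) * (∏ k ∈ s.erase k, (D.γ ^ (k : ℕ)) (u k)) *
          (D.γ ^ (k : ℕ)) (D.twist e (u k * v)) ∈ Submodule.span F (D.standardProducts (d + 1)) := by
      intro e he
      rw [rotate_twist k hz he, mul_smul_comm]
      refine Submodule.smul_mem _ _ (Submodule.subset_span
        ⟨K, ⟨D.twist e (u k * v), 2, e⟩ ::ₘ Q, s.erase k, u, hK, ?_, hu, ?_, ?_⟩)
      · simp only [Multiset.forall_mem_cons]
        refine ⟨⟨c', rfl, u k, v, hc', ?_, rfl⟩, hQ⟩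
        simpa [he] using hv
      · rw [Multiset.add_cons, sumDeg_cons, Finset.card_erase_of_mem hk, ← hd]
        have := Finset.card_pos.2 ⟨k, hk⟩
        dsimp only
        omega
      · rw [Multiset.add_cons, prodVal_cons]; ring
    have heq : prodVal (K + Q) * (∏ k ∈ s, (D.γ ^ (k : ℕ)) (u k)) * (D.γ ^ (k : ℕ)) v =
        prodVal (K + Q) * (∏ k ∈ s.erase k, (D.γ ^ (k : ℕ)) (u k)) *
          (D.γ ^ (k : ℕ)) (u k * v) := by
      rw [← Finset.mul_prod_erase s _ hk, map_mul]; ring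
    rw [heq]
    refine mem_of_three_smul_mem (D := D) ?_
    rw [← mul_smul_comm, ← map_smul, three_smul_eq_sum_twist e, map_add, map_add, mul_add, mul_add]
    have h : ∀ e : ZMod 9, 3 * (e + 3) = 3 * e ∧ 3 * (e + 6) = 3 * e := by decide
    exact add_mem (add_mem (key _ he) (key _ ((h e).1.trans he))) (key _ ((h e).2.trans he))
  · refine Submodule.subset_span ⟨K, Q, insert k s, Function.update u k v, hK, hQ, ?_, ?_, ?_⟩
    · intro i
      by_cases hi : i = k
      · subst hi; exact ⟨c, by simpa using hv⟩
      · simpa [Function.update_of_ne hi] using hu i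
    · rw [Finset.card_insert_of_notMem hk, ← hd]; ring
    · rw [Finset.prod_insert hk, Function.update_self]
      have : ∏ i ∈ s, (D.γ ^ (i : ℕ)) (Function.update u k v i) = ∏ i ∈ s, (D.γ ^ (i : ℕ)) (u i) :=
        Finset.prod_congr rfl fun i hi => by
          rw [Function.update_of_ne (by rintro rfl; exact hk hi)]
      rw [this]; ring

theorem pow_le_span_standardProducts (d : ℕ) :
    D.L ^ d ≤ Submodule.span F (D.standardProducts d) := by
  induction d with
  | zero =>
    rw [pow_zero, Submodule.one_le]
    -- The zero form counts as a letter, so it can fill the unused slots of u.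
    refine Submodule.subset_span ⟨0, 0, ∅, 0, by simp, by simp, fun k => ⟨0, ?_⟩, by simp, by simp⟩
    exact ⟨by simp, by simp, by simp, by simp, by simp⟩
  | succ d ih =>
    rw [pow_succ]
    refine (mul_le_mul' ih L_le_span_basicForms).trans ?_
    rw [Submodule.span_mul_span, Submodule.span_le]
    rintro _ ⟨f, hf, x, hx, rfl⟩
    exact mul_mem_span_standardProducts hf hx

/-! ### Averaging over the group -/

variable (D) in
/-- The sum over the orbit of `⟨σ, τ⟩`. -/
def traceN : R →ₗ[F] R :=
  LinearMap.id + D.σ.toLinearMap + D.τ.toLinearMap + D.σ.toLinearMap ∘ₗ D.τ.toLinearMap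

theorem traceN_apply (x : R) : D.traceN x = x + D.σ x + D.τ x + D.σ (D.τ x) := rfl

variable (D) in
/-- The sum over the orbit of `γ`. -/
def traceγ : R →ₗ[F] R := ∑ k ∈ Finset.range 9, (D.γ ^ k).toLinearMap

theorem traceγ_apply (x : R) : D.traceγ x = ∑ k ∈ Finset.range 9, (D.γ ^ k) x := by
  simp [traceγ]

theorem γ_pow_nine (x : R) : (D.γ ^ 9) x = x := by
  simpa [pow_succ, AlgHom.mul_apply] using D.γ_nine x

theorem γ_traceγ (x : R) : D.γ (D.traceγ x) = D.traceγ x := by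
  rw [traceγ_apply, map_sum]
  simp only [← AlgHom.mul_apply, ← pow_succ']
  have h1 := Finset.sum_range_succ (fun k => (D.γ ^ k) x) 9
  have h2 := Finset.sum_range_succ' (fun k => (D.γ ^ k) x) 9
  rw [γ_pow_nine] at h1
  rw [h1] at h2
  simpa using h2.symm

theorem γ_pow_apply {c : F} {x : R} (hx : D.γ x = c • x) (n : ℕ) : (D.γ ^ n) x = c ^ n • x := by
  induction n with
  | zero => simp
  | succ n ih => rw [pow_succ', AlgHom.mul_apply, ih, map_smul, hx, smul_smul, pow_succ]

theorem traceγ_of_γ_eq {x : R} (hx : D.γ x = x) : D.traceγ x = (9 : F) • x := by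
  rw [traceγ_apply]
  simp only [γ_pow_apply (c := (1 : F)) (x := x) (by rwa [one_smul]), one_pow, one_smul]
  rw [Finset.sum_const, Finset.card_range, ← Nat.cast_smul_eq_nsmul F]
  norm_num

/-- Every nonzero e has 3 among its multiples, and χ(3) = 1 would turn the relation on χ(3) into 3 =
0. -/
theorem eq_zero_of_chi_eq_one {e : ZMod 9} (h : D.χ e = 1) : e = 0 := by
  by_contra h0
  have key : ∀ e : ZMod 9, e ≠ 0 → ∃ m : Fin 9, (m : ℕ) • e = 3 := by decide
  obtain ⟨m, hm⟩ := key e h0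
  have h3 := D.χ.map_nsmul_eq_pow (m : ℕ) e
  rw [hm, h, one_pow] at h3
  have := D.chi_three
  rw [h3] at this
  exact D.three_ne_zero (by linear_combination this)

theorem traceγ_eq_zero {e : ZMod 9} (he : e ≠ 0) {x : R} (hx : D.γ x = D.χ e • x) :
    D.traceγ x = 0 := by
  have h1 : D.traceγ x = (∑ k ∈ Finset.range 9, D.χ e ^ k) • x := by
    rw [traceγ_apply, Finset.sum_smul]
    exact Finset.sum_congr rfl fun k _ => γ_pow_apply hx k
  have h2 := D.γ_traceγ x
  have h3 : D.γ (D.traceγ x) = D.χ e • D.traceγ x := by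
    rw [h1, map_smul, hx, smul_comm]
  have h4 : (D.χ e - 1) • D.traceγ x = 0 := by rw [sub_smul, one_smul, ← h3, h2, sub_self]
  have h5 : D.χ e - 1 ≠ 0 := fun h => he (eq_zero_of_chi_eq_one (sub_eq_zero.1 h))
  exact (smul_eq_zero_iff_right h5).1 h4

theorem trace_mem_Inv {d : ℕ} {x : R} (hx : x ∈ D.L ^ d) :
    D.traceγ (D.traceN x) ∈ D.Inv d 0 := by
  have hpow : ∀ f : R →ₐ[F] R, (∀ y ∈ D.L, f y ∈ D.L) → ∀ y ∈ D.L ^ d, f y ∈ D.L ^ d := by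
    intro f hf y hy
    have : (D.L ^ d).map f.toLinearMap ≤ D.L ^ d := by
      rw [Submodule.map_pow]
      exact pow_le_pow_left' (by rintro _ ⟨y, hy, rfl⟩; exact hf y hy) d
    exact this ⟨y, hy, rfl⟩
  have hN : D.traceN x ∈ D.L ^ d ∧ D.σ (D.traceN x) = D.traceN x ∧
      D.τ (D.traceN x) = D.traceN x := by
    have hs := hpow _ D.σ_mem
    have ht := hpow _ D.τ_mem
    refine ⟨add_mem (add_mem (add_mem hx (hs x hx)) (ht x hx)) (hs _ (ht x hx)), ?_, ?_⟩
    · simp only [traceN_apply, map_add, D.σ_σ]; abel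
    · simp only [traceN_apply, map_add, D.σ_τ, D.τ_τ]; abel
  have hk : ∀ k, (D.γ ^ k) (D.traceN x) ∈ D.L ^ d ∧
      D.σ ((D.γ ^ k) (D.traceN x)) = (D.γ ^ k) (D.traceN x) ∧
      D.τ ((D.γ ^ k) (D.traceN x)) = (D.γ ^ k) (D.traceN x) := by
    intro k
    induction k with
    | zero => simpa using hN
    | succ k ih =>
      rw [pow_succ', AlgHom.mul_apply]
      exact ⟨γ_mem_pow ih.1, by rw [D.σ_γ, ih.2.2], by rw [D.τ_γ, ih.2.2, ih.2.1]⟩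
  refine ⟨?_, ?_, ?_, ?_⟩
  · rw [traceγ_apply]; exact sum_mem fun k _ => (hk k).1
  · rw [traceγ_apply, map_sum]; exact Finset.sum_congr rfl fun k _ => (hk k).2.1
  · rw [traceγ_apply, map_sum]; exact Finset.sum_congr rfl fun k _ => (hk k).2.2
  · rw [γ_traceγ, AddChar.map_zero_eq_one, one_smul]

theorem trace_of_fixed {x : R} (hσ : D.σ x = x) (hτ : D.τ x = x) (hγ : D.γ x = x) :
    D.traceγ (D.traceN x) = (36 : F) • x := by
  rw [traceN_apply, hτ, hσ, ← two_smul F x, add_assoc, ← two_smul F x]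
  rw [map_add, map_smul, traceγ_of_γ_eq hγ]
  module

theorem thirty_six_ne_zero (D : TwistedTetrahedralAction F R) : (36 : F) ≠ 0 := by
  rw [show (36 : F) = 2 * 2 * 3 * 3 by norm_num]
  exact mul_ne_zero (mul_ne_zero (mul_ne_zero D.two_ne_zero D.two_ne_zero) D.three_ne_zero)
    D.three_ne_zero

/-- The three rotations carry the three nontrivial characters of N, and a product of one or two
distinct ones is nontrivial, so its sum over N vanishes. -/
theorem traceN_rotated_letters {u : Fin 3 → R} (hu : ∀ k, ∃ c, D.IsLetter c (u k))
    (s : Finset (Fin 3)) (h0 : s ≠ ∅) (h1 : s ≠ Finset.univ) :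
    D.traceN (∏ k ∈ s, (D.γ ^ (k : ℕ)) (u k)) = 0 := by
  choose c hc using hu
  have hσ : ∀ k : Fin 3, D.σ ((D.γ ^ (k : ℕ)) (u k)) = (![1, -1, -1] k : ℤ) • (D.γ ^ (k : ℕ)) (u k) := by
    intro k
    fin_cases k <;> simp [pow_two, D.σ_γ, D.τ_γ, (hc _).σ_eq, (hc _).τ_eq]
  have hτ : ∀ k : Fin 3, D.τ ((D.γ ^ (k : ℕ)) (u k)) = (![-1, -1, 1] k : ℤ) • (D.γ ^ (k : ℕ)) (u k) := by
    intro k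
    fin_cases k <;> simp [pow_two, D.σ_γ, D.τ_γ, (hc _).σ_eq, (hc _).τ_eq]
  have hσ' : D.σ (∏ k ∈ s, (D.γ ^ (k : ℕ)) (u k)) =
      (∏ k ∈ s, (![1, -1, -1] k : ℤ)) • ∏ k ∈ s, (D.γ ^ (k : ℕ)) (u k) := by
    rw [map_prod, Finset.prod_congr rfl fun k _ => hσ k, Finset.prod_smul]
  have hτ' : D.τ (∏ k ∈ s, (D.γ ^ (k : ℕ)) (u k)) =
      (∏ k ∈ s, (![-1, -1, 1] k : ℤ)) • ∏ k ∈ s, (D.γ ^ (k : ℕ)) (u k) := by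
    rw [map_prod, Finset.prod_congr rfl fun k _ => hτ k, Finset.prod_smul]
  have key : ∀ s : Finset (Fin 3), s ≠ ∅ → s ≠ Finset.univ →
      1 + (∏ k ∈ s, (![1, -1, -1] k : ℤ)) + (∏ k ∈ s, (![-1, -1, 1] k : ℤ)) +
        (∏ k ∈ s, (![-1, -1, 1] k : ℤ)) * (∏ k ∈ s, (![1, -1, -1] k : ℤ)) = 0 := by decide
  rw [traceN_apply, hτ', map_zsmul, hσ', smul_smul]
  nth_rewrite 1 [← one_zsmul (∏ k ∈ s, (D.γ ^ (k : ℕ)) (u k))]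
  rw [← add_smul, ← add_smul, ← add_smul, key s h0 h1, zero_smul]

theorem traceN_mul {a x : R} (hσ : D.σ a = a) (hτ : D.τ a = a) :
    D.traceN (a * x) = a * D.traceN x := by
  simp only [traceN_apply, map_mul, hσ, hτ]; ring

/-- Homogeneous invariants of every degree lie in any subalgebra containing those of degree
at most 17. -/
theorem Inv_zero_le {B : Subalgebra F R} (hB : ∀ i ≤ 17, ∀ x ∈ D.Inv i 0, x ∈ B) (d : ℕ) :
    ∀ x ∈ D.Inv d 0, x ∈ B := by
  induction d using Nat.strong_induction_on with
  | _ d ih =>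
  by_cases h17 : d ≤ 17
  · exact hB d h17
  -- The average is 36 times the product if the total weight is zero, and zero otherwise.
  have hprod : ∀ K Q C : Multiset (Factor R), (∀ a ∈ K, D.IsLinear a) →
      (∀ a ∈ Q, ∃ c, D.IsQuad c a) → (∀ a ∈ C, D.IsFactor a ∧ a.deg = 3) → C.card ≤ 1 →
      sumDeg (K + Q + C) = d → D.traceγ (D.traceN (prodVal (K + Q + C))) ∈ B := by
    intro K Q C hK hQ hC hC1 hd
    have hF : ∀ a ∈ K + Q + C, D.IsFactor a := by
      intro a ha
      simp only [Multiset.mem_add] at ha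
      rcases ha with (h | h) | h
      · exact (hK a h).2
      · exact (hQ a h).choose_spec.isFactor
      · exact (hC a h).1
    obtain ⟨-, hσ, hτ, hγ⟩ := prodVal_mem_Inv hF
    by_cases hw : sumWt (K + Q + C) = 0
    · rw [hw, AddChar.map_zero_eq_one, one_smul] at hγ
      rw [trace_of_fixed hσ hτ hγ]
      exact B.smul_mem (prodVal_mem_of_le ih hK hQ hC hC1 hd hw (by omega)) _
    · rw [traceN_apply, hτ, hσ]
      simp only [map_add, traceγ_eq_zero hw hγ, add_zero]
      exact zero_mem B
  have hstd : D.standardProducts d ⊆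
      (Subalgebra.toSubmodule B).comap (D.traceγ ∘ₗ D.traceN) := by
    rintro _ ⟨K, Q, s, u, hK, hQ, hu, hd, rfl⟩
    change D.traceγ (D.traceN _) ∈ B
    have hF : ∀ a ∈ K + Q, D.IsFactor a := by
      intro a ha
      rcases Multiset.mem_add.1 ha with h | h
      · exact (hK a h).2
      · exact (hQ a h).choose_spec.isFactor
    by_cases h0 : s = ∅
    · subst h0
      have := hprod K Q 0 hK hQ (by simp) (by simp) (by simpa using hd)
      simpa using this
    by_cases h1 : s = Finset.univ
    · subst h1
      choose c hc using hu
      have hz := (hc 0).mul_mul (hc 1) (hc 2)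
      obtain ⟨e, he⟩ := exists_three_mul_eq (c := c 0 + c 1 + c 2) (by
        rw [mul_add, mul_add, (hc 0).three_mul, (hc 1).three_mul, (hc 2).three_mul, add_zero,
          add_zero])
      have key : ∀ e, 3 * e = c 0 + c 1 + c 2 → D.traceγ (D.traceN (prodVal (K + Q) *
          D.twist e (u 0 * D.γ (u 1) * D.γ (D.γ (u 2))))) ∈ Subalgebra.toSubmodule B := by
        intro e he
        have := hprod K Q {⟨D.twist e (u 0 * D.γ (u 1) * D.γ (D.γ (u 2))), 3, e⟩} hK hQ
          (by simpa using ⟨by norm_num, hz.twist_mem he⟩) (by simp) (by simpa [sumDeg] using hd)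
        rw [prodVal_add] at this
        simpa [prodVal] using this
      have heq : ∏ k : Fin 3, (D.γ ^ (k : ℕ)) (u k) = u 0 * D.γ (u 1) * D.γ (D.γ (u 2)) := by
        simp [Fin.prod_univ_three]
      rw [heq]
      change _ ∈ Subalgebra.toSubmodule B
      refine mem_of_three_smul_mem (D := D) ?_
      rw [← map_smul, ← map_smul, ← mul_smul_comm, three_smul_eq_sum_twist e]
      simp only [mul_add, map_add]
      have h : ∀ e : ZMod 9, 3 * (e + 3) = 3 * e ∧ 3 * (e + 6) = 3 * e := by decide
      exact add_mem (add_mem (key _ he) (key _ ((h e).1.trans he))) (key _ ((h e).2.trans he))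
    · obtain ⟨-, hσ, hτ, -⟩ := prodVal_mem_Inv hF
      rw [traceN_mul hσ hτ, traceN_rotated_letters hu s h0 h1, mul_zero, map_zero]
      exact zero_mem B
  intro x hx
  have h1 := Submodule.span_le.2 hstd (pow_le_span_standardProducts d hx.1)
  obtain ⟨-, hσ, hτ, hγ⟩ := hx
  rw [AddChar.map_zero_eq_one, one_smul] at hγ
  change D.traceγ (D.traceN x) ∈ Subalgebra.toSubmodule B at h1
  rw [trace_of_fixed hσ hτ hγ] at h1
  exact (Submodule.smul_mem_iff _ D.thirty_six_ne_zero).1 h1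

/-- Here x need not be homogeneous: the trace maps each homogeneous part into B, and 36x is the
trace of x. -/
theorem mem_of_fixed {B : Subalgebra F R} (hB : ∀ i ≤ 17, ∀ x ∈ D.Inv i 0, x ∈ B)
    (hL : ⨆ d, D.L ^ d = ⊤) {x : R} (hσ : D.σ x = x) (hτ : D.τ x = x) (hγ : D.γ x = x) :
    x ∈ B := by
  have h : (⊤ : Submodule F R) ≤ (Subalgebra.toSubmodule B).comap (D.traceγ ∘ₗ D.traceN) := by
    rw [← hL, iSup_le_iff]
    exact fun d y hy => Inv_zero_le hB d _ (trace_mem_Inv hy)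
  have h1 : D.traceγ (D.traceN x) ∈ Subalgebra.toSubmodule B := h trivial
  rw [trace_of_fixed hσ hτ hγ] at h1
  exact (Submodule.smul_mem_iff _ D.thirty_six_ne_zero).1 h1

end TwistedTetrahedralAction

/-! ### The action on the coordinate ring -/

section Act

variable {F : Type*} [Field F] {V : Type*} [AddCommGroup V] [Module F V] {G : Type*} [Group G]

theorem act_ι (ρ : Representation F G V) (g : G) (x : Module.Dual F V) :
    act ρ g (SymmetricAlgebra.ι F _ x) = SymmetricAlgebra.ι F _ ((ρ g).dualMap x) := by
  simp [act]

/-- The action is from the right, which fixes the order of composition in the relations between σ, τ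
and γ. -/
theorem act_mul (ρ : Representation F G V) (g h : G) (f : CoordRing F V) :
    act ρ (g * h) f = act ρ h (act ρ g f) := by
  have : act ρ (g * h) = (act ρ h).comp (act ρ g) := by
    apply SymmetricAlgebra.algHom_ext
    refine LinearMap.ext fun x => ?_
    change act ρ (g * h) (SymmetricAlgebra.ι F _ x) = act ρ h (act ρ g (SymmetricAlgebra.ι F _ x))
    rw [act_ι, act_ι, act_ι]
    congr 1
    ext v
    simp
  rw [this, AlgHom.comp_apply]

theorem act_one (ρ : Representation F G V) (f : CoordRing F V) : act ρ 1 f = f := by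
  have : act ρ 1 = AlgHom.id F _ := by
    apply SymmetricAlgebra.algHom_ext
    refine LinearMap.ext fun x => ?_
    change act ρ 1 (SymmetricAlgebra.ι F _ x) = SymmetricAlgebra.ι F _ x
    rw [act_ι]
    congr 1
    ext v
    simp
  rw [this, AlgHom.id_apply]

theorem act_mem_range_ι (ρ : Representation F G V) (g : G) {f : CoordRing F V}
    (hf : f ∈ LinearMap.range (SymmetricAlgebra.ι F (Module.Dual F V))) :
    act ρ g f ∈ LinearMap.range (SymmetricAlgebra.ι F (Module.Dual F V)) := by
  obtain ⟨x, rfl⟩ := hf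
  exact ⟨_, (act_ι ρ g x).symm⟩

theorem mem_invariantAlgebra {ρ : Representation F G V} {f : CoordRing F V} :
    f ∈ invariantAlgebra ρ ↔ ∀ g, act ρ g f = f := by
  simp [invariantAlgebra, Algebra.mem_iInf]

theorem act_pow_eq_self {ρ : Representation F G V} {g : G} {f : CoordRing F V}
    (h : act ρ g f = f) (n : ℕ) : act ρ (g ^ n) f = f := by
  induction n with
  | zero => rw [pow_zero, act_one]
  | succ n ih => rw [pow_succ, act_mul, ih, h]

theorem iSup_homogeneousPart_eq_top : ⨆ d, homogeneousPart F V d = ⊤ := by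
  have hmul : (⨆ d, homogeneousPart F V d) * (⨆ d, homogeneousPart F V d) ≤
      ⨆ d, homogeneousPart F V d := by
    simp only [Submodule.iSup_mul, Submodule.mul_iSup, iSup_le_iff]
    intro i j
    rw [homogeneousPart, homogeneousPart, ← pow_add]
    exact le_iSup (homogeneousPart F V) (j + i)
  rw [eq_top_iff]
  rintro x -
  induction x using SymmetricAlgebra.induction with
  | algebraMap r =>
    refine Submodule.mem_iSup_of_mem 0 ?_
    rw [homogeneousPart, pow_zero, Submodule.mem_one]
    exact ⟨r, rfl⟩
  | ι x =>
    refine Submodule.mem_iSup_of_mem 1 ?_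
    rw [homogeneousPart, pow_one]
    exact ⟨x, rfl⟩
  | mul a b ha hb => exact hmul (Submodule.mul_mem_mul ha hb)
  | add a b ha hb => exact add_mem ha hb

theorem exists_addChar_zmod_nine [IsAlgClosed F] (h3 : (3 : F) ≠ 0) :
    ∃ χ : AddChar (ZMod 9) F, χ 3 ^ 2 + χ 3 + 1 = 0 := by
  have : NeZero ((9 : ℕ) : F) := ⟨by
    rw [show ((9 : ℕ) : F) = 3 * 3 by norm_num]; exact mul_ne_zero h3 h3⟩
  obtain ⟨ζ, hζ⟩ := HasEnoughRootsOfUnity.exists_primitiveRoot F 9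
  refine ⟨AddChar.zmodChar 9 hζ.pow_eq_one, ?_⟩
  have h : (AddChar.zmodChar 9 hζ.pow_eq_one) 3 = ζ ^ 3 := by rw [AddChar.zmodChar_apply]; rfl
  have hne : ζ ^ 3 - 1 ≠ 0 := sub_ne_zero.2 (hζ.pow_ne_one_of_pos_of_lt (by norm_num) (by norm_num))
  rw [h]
  apply mul_left_cancel₀ hne
  linear_combination hζ.pow_eq_one

end Act

/-! ### From the semidirect product to the abstract action -/

/-- The linear map of `𝔽₂²` sending the standard basis to `p`, `q`. -/
def binaryMap (p q x : ZMod 2 × ZMod 2) : ZMod 2 × ZMod 2 := x.1.val • p + x.2.val • q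

-- A nontrivial automorphism of 𝔽₂² whose ninth power is trivial has order 3 and satisfies α² = 1 +
-- α; the finitely many pairs (p, q) are checked.
set_option synthInstance.maxSize 2000 in
theorem binaryMap_cycle : ∀ p q : ZMod 2 × ZMod 2,
    (∀ x, (binaryMap p q)^[9] x = x) → (¬ ∀ x, binaryMap p q x = x) →
    binaryMap p q p = (1, 0) + p ∧ ∀ n, n = 0 ∨ n = (1, 0) ∨ n = p ∨ n = (1, 0) + p := by
  decide

theorem additive_aut_cycle (f : ZMod 2 × ZMod 2 →+ ZMod 2 × ZMod 2)
    (h9 : ∀ x, f (f (f (f (f (f (f (f (f x)))))))) = x) (h1 : ¬ ∀ x, f x = x) :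
    f (f (1, 0)) = (1, 0) + f (1, 0) ∧
      ∀ n, n = 0 ∨ n = (1, 0) ∨ n = f (1, 0) ∨ n = (1, 0) + f (1, 0) := by
  have hf : ⇑f = binaryMap (f (1, 0)) (f (0, 1)) := by
    funext x
    rw [binaryMap, ← map_nsmul, ← map_nsmul, ← map_add]
    congr 1
    revert x
    decide
  have h := binaryMap_cycle (f (1, 0)) (f (0, 1))
  rw [← hf] at h
  exact h h9 h1

open Multiplicative SemidirectProduct

theorem mem_adjoin_of_mem_invariantAlgebra {F : Type*} [Field F] [IsAlgClosed F]
    (h2 : (2 : F) ≠ 0) (h3 : (3 : F) ≠ 0)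
    {φ : Multiplicative (ZMod 9) →* MulAut (Multiplicative (ZMod 2 × ZMod 2))}
    (hφ : ¬ ∀ x y : Multiplicative (ZMod 2 × ZMod 2) ⋊[φ] Multiplicative (ZMod 9), x * y = y * x)
    {V : Type*} [AddCommGroup V] [Module F V]
    (ρ : Representation F (Multiplicative (ZMod 2 × ZMod 2) ⋊[φ] Multiplicative (ZMod 9)) V)
    {f : CoordRing F V} (hf : f ∈ invariantAlgebra ρ) :
    f ∈ Algebra.adjoin F
      {f : CoordRing F V | f ∈ invariantAlgebra ρ ∧ ∃ i ≤ 17, f ∈ homogeneousPart F V i} := by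
  obtain ⟨χ, hχ⟩ := exists_addChar_zmod_nine (F := F) h3
  set t : Multiplicative (ZMod 9) := ofAdd 1
  have ht : ∀ z : Multiplicative (ZMod 9), ∃ n : ℕ, z = t ^ n := by
    intro z
    refine ⟨(toAdd z).val, ?_⟩
    rw [← ofAdd_nsmul, nsmul_one, ZMod.natCast_zmod_val]
    rfl
  have ht9 : t ^ 9 = 1 := by decide
  set α : ZMod 2 × ZMod 2 →+ ZMod 2 × ZMod 2 :=
    AddMonoidHom.toMultiplicative.symm (φ t).toMonoidHom
  have hα : ∀ x, φ t (ofAdd x) = ofAdd (α x) := fun x => rfl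
  have hα9 : ∀ x, α (α (α (α (α (α (α (α (α x)))))))) = x := by
    intro x
    have h : ((φ t) ^ 9) (ofAdd x) = ofAdd x := by rw [← map_pow, ht9, map_one, MulAut.one_apply]
    exact h
  have hα1 : ¬ ∀ x, α x = x := by
    intro h
    have h1 : φ t = 1 := MulEquiv.ext h
    have h1' : φ = 1 := by
      refine MonoidHom.ext fun z => ?_
      obtain ⟨n, rfl⟩ := ht z
      rw [map_pow, h1, one_pow, MonoidHom.one_apply]
    subst h1'
    apply hφ
    intro x y
    apply SemidirectProduct.ext
    · simp [mul_comm]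
    · simp [mul_comm]
  obtain ⟨hα2, hαn⟩ := additive_aut_cycle α hα9 hα1
  set n₁ : Multiplicative (ZMod 2 × ZMod 2) := ofAdd (1, 0)
  set n₂ : Multiplicative (ZMod 2 × ZMod 2) := φ t n₁
  have hn₂ : φ t n₂ = n₁ * n₂ := hα2
  have hcomm : ∀ n, (inr t * inl n : Multiplicative (ZMod 2 × ZMod 2) ⋊[φ] Multiplicative (ZMod 9)) =
      inl (φ t n) * inr t := by
    intro n
    rw [inl_aut, map_inv, inv_mul_cancel_right]
  have hsq : ∀ n : Multiplicative (ZMod 2 × ZMod 2), n * n = 1 := by decide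
  let D : TwistedTetrahedralAction F (CoordRing F V) :=
    { L := LinearMap.range (SymmetricAlgebra.ι F (Module.Dual F V))
      σ := act ρ (inl n₁)
      τ := act ρ (inl n₂)
      γ := act ρ (inr t)
      χ := χ
      two_ne_zero := h2
      three_ne_zero := h3
      chi_three := hχ
      σ_mem := fun x hx => act_mem_range_ι ρ _ hx
      τ_mem := fun x hx => act_mem_range_ι ρ _ hx
      γ_mem := fun x hx => act_mem_range_ι ρ _ hx
      σ_σ := fun x => by rw [← act_mul, ← map_mul, hsq, map_one, act_one]
      τ_τ := fun x => by rw [← act_mul, ← map_mul, hsq, map_one, act_one]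
      σ_τ := fun x => by rw [← act_mul, ← act_mul, ← map_mul, ← map_mul, mul_comm]
      σ_γ := fun x => by rw [← act_mul, ← act_mul, hcomm]
      τ_γ := fun x => by
        rw [← act_mul, ← act_mul, ← act_mul, hcomm, hn₂, ← mul_assoc, ← map_mul, mul_comm n₁]
      γ_nine := fun x => by
        simp only [← act_mul, ← map_mul]
        have : t * t * t * t * t * t * t * t * t = 1 := by decide
        rw [this, map_one, act_one] }
  -- The orbit of (1, 0) gives all nonzero elements of N, so n₁, n₂ and t generate the group.
  have hfix : ∀ x : CoordRing F V, D.σ x = x → D.τ x = x → D.γ x = x → x ∈ invariantAlgebra ρ := by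
    intro x hσ hτ hγ
    rw [mem_invariantAlgebra]
    intro g
    rw [← inl_left_mul_inr_right g, act_mul]
    obtain ⟨k, hk⟩ := ht g.right
    have hN : act ρ (inl g.left) x = x := by
      have hσ' : act ρ (inl n₁) x = x := hσ
      have hτ' : act ρ (inl n₂) x = x := hτ
      rcases hαn (toAdd g.left) with h | h | h | h
      · rw [show g.left = 1 from h, map_one, act_one]
      · rw [show g.left = n₁ from h, hσ']
      · rw [show g.left = n₂ from h, hτ']
      · rw [show g.left = n₁ * n₂ from h, map_mul, act_mul, hσ', hτ']
    rw [hN, hk, map_pow]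
    exact act_pow_eq_self hγ k
  rw [mem_invariantAlgebra] at hf
  refine TwistedTetrahedralAction.mem_of_fixed (D := D) ?_ iSup_homogeneousPart_eq_top (hf _) (hf _)
    (hf _)
  rintro i hi x ⟨hx, hσ, hτ, hγ⟩
  rw [AddChar.map_zero_eq_one, one_smul] at hγ
  exact Algebra.subset_adjoin ⟨hfix x hσ hτ hγ, i, hi, hx⟩

end InvariantTheory

theorem proposition3p6 (F : Type u) [Field F] [IsAlgClosed F]
    (h2 : ringChar F ≠ 2) (h3 : ringChar F ≠ 3)
    (φ : Multiplicative (ZMod 9) →* MulAut (Multiplicative (ZMod 2 × ZMod 2)))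
    (hφ : ¬ ∀ x y : Multiplicative (ZMod 2 × ZMod 2) ⋊[φ] Multiplicative (ZMod 9),
      x * y = y * x) :
    InvariantTheory.noetherNumber F
      (Multiplicative (ZMod 2 × ZMod 2) ⋊[φ] Multiplicative (ZMod 9)) ≤ 17 := by
  have hp : ∀ p : ℕ, p.Prime → ringChar F ≠ p → (p : F) ≠ 0 := by
    intro p hp h h0
    exact h ((Nat.prime_dvd_prime_iff_eq
      ((CharP.char_is_prime_or_zero F (ringChar F)).resolve_right fun hc => by
        rw [ringChar.spec, hc, zero_dvd_iff] at h0
        exact hp.ne_zero h0) hp).1 ((ringChar.spec F p).1 h0))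
  have h2' : (2 : F) ≠ 0 := by exact_mod_cast hp 2 Nat.prime_two h2
  have h3' : (3 : F) ≠ 0 := by exact_mod_cast hp 3 Nat.prime_three h3
  unfold InvariantTheory.noetherNumber
  refine iSup_le fun V => iSup_le fun _ => iSup_le fun _ => iSup_le fun _ => iSup_le fun ρ => ?_
  have h : InvariantTheory.GeneratedInDegreeLE ρ 17 := by
    refine le_antisymm (Algebra.adjoin_le fun f hf => hf.1) fun f hf => ?_
    exact InvariantTheory.mem_adjoin_of_mem_invariantAlgebra h2' h3' hφ ρ hf
  exact iInf₂_le (17 : ℕ) h
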